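/- Let $k$ be a perfect field of characteristic $p>0$ and let $X$ be a smooth scheme over $k$. Write $\Omega^i_X$ for the sheaf of differential forms of degree $i$ of $X$ over $k$, $F\colon X\to X$ for the absolute Frobenius morphism, and $F_*\Omega_X^\bullet$ for the push-forward of the de Rham complex, a complex of $\mathcal{O}_X$-modules with $\mathcal{O}_X$-linear differential $F_*d$. Put $$Z_1\Omega^i_X=\operatorname{Ker}(F_*d\colon F_*\Omega^i_X\to F_*\Omega^{i+1}_X),\qquad B_1\Omega^{i+1}_X=\operatorname{Im}(F_*d\colon F_*\Omega^{i}_X\to F_*\Omega^{i+1}_X).$$ Let $C^{-1}\colon\Omega^i_X\to\mathcal{H}^i(F_*\Omega^\bullet_X)$ be the $\mathcal{O}_X$-linear map determined by $$a\,db_1\wedge\cdots\wedge db_i\;\mapsto\;\bigl[a^p(b_1\cdots b_i)^{p-1}db_1\wedge\cdots\wedge db_i\bigr].$$ Then $C^{-1}$ is an isomorphism. Let $C\colon Z_1\Omega^i_X\to\Omega^i_X$ be the Cartier operator, i.e. the projection $Z_1\Omega^i_X\to\mathcal{H}^i(F_*\Omega_X^\bullet)$ followed by the inverse of $C^{-1}$.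 Define submodules $Z_n\Omega^i_X\subseteq F^n_*\Omega^i_X$ inductively by $Z_0\Omega^i_X=\Omega^i_X$ and $$Z_{n}\Omega^i_X=(F^{n-1}_*C)^{-1}(Z_{n-1}\Omega^i_X)\subseteq F^{n-1}_*Z_1\Omega^i_X\subseteq F^{n}_*\Omega^i_X\qquad(n\ge 1),$$ and let the higher Cartier operator $C^n\colon Z_n\Omega^i_X\to\Omega^i_X$ be the composition $Z_n\Omega^i_X\to Z_{n-1}\Omega^i_X\to\cdots\to Z_0\Omega^i_X=\Omega^i_X$ of the restrictions of $F^{n-1}_*C,\dots,F_*C,C$ (so $C^0=\mathrm{id}$). Then for all $i\ge 0$ and $n\ge 1$ one has $Z_n\Omega^i_X\subseteq F_*Z_{n-1}\Omega^i_X$ inside $F^n_*\Omega^i_X$, and the sequence of $\mathcal{O}_X$-modules $$0\to Z_n\Omega^i_X\to F_*Z_{n-1}\Omega^i_X\xrightarrow{\;F_*d\,\circ\,F_*C^{n-1}\;}B_1\Omega^{i+1}_X\to 0,$$ whose first map is the inclusion, is exact. Moreover it is the pullback along $F_*C^{n-1}\colon F_*Z_{n-1}\Omega^i_X\to F_*\Omega^i_X$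 of the exact sequence $$0\to Z_1\Omega^i_X\to F_*\Omega^i_X\xrightarrow{\;F_*d\;}B_1\Omega^{i+1}_X\to 0:$$ the square formed by the inclusions $Z_n\Omega^i_X\to F_*Z_{n-1}\Omega^i_X$ and $Z_1\Omega^i_X\to F_*\Omega^i_X$, the map $F_*C^{n-1}$, and the composition $Z_n\Omega^i_X\to Z_{n-1}\Omega^i_X\to\cdots\to Z_1\Omega^i_X$ of the restrictions of $F^{n-1}_*C,\dots,F_*C$, is Cartesian. -/

import Mathlib

open CategoryTheory AlgebraicGeometry

universe u

noncomputable section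

/-! ### The algebraic de Rham algebra -/

namespace DeRham

open CliffordAlgebra (involute)
open ExteriorAlgebra (ι)

section Twisted

/-- The upper triangular `2 × 2` matrices over `R` with diagonal `(s x, x)` and upper right entry
`y`, stored as pairs `(x, y)`. -/
@[ext] structure Triangular {R : Type*} [Ring R] (s : R →+* R) where
  x : R
  y : R

variable {R : Type*} [Ring R] (s : R →+* R)

namespace Triangular

instance : Zero (Triangular s) := ⟨⟨0, 0⟩⟩
instance : One (Triangular s) := ⟨⟨1, 0⟩⟩
instance : Add (Triangular s) := ⟨fun a b => ⟨a.x + b.x, a.y + b.y⟩⟩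
instance : Neg (Triangular s) := ⟨fun a => ⟨-a.x, -a.y⟩⟩
instance : Mul (Triangular s) := ⟨fun a b => ⟨a.x * b.x, s a.x * b.y + a.y * b.x⟩⟩

@[simp] lemma zero_x : (0 : Triangular s).x = 0 := rfl
@[simp] lemma zero_y : (0 : Triangular s).y = 0 := rfl
@[simp] lemma one_x : (1 : Triangular s).x = 1 := rfl
@[simp] lemma one_y : (1 : Triangular s).y = 0 := rfl
@[simp] lemma add_x (a b : Triangular s) : (a + b).x = a.x + b.x := rfl
@[simp] lemma add_y (a b : Triangular s) : (a + b).y = a.y + b.y := rfl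
@[simp] lemma neg_x (a : Triangular s) : (-a).x = -a.x := rfl
@[simp] lemma neg_y (a : Triangular s) : (-a).y = -a.y := rfl
@[simp] lemma mul_x (a b : Triangular s) : (a * b).x = a.x * b.x := rfl
@[simp] lemma mul_y (a b : Triangular s) : (a * b).y = s a.x * b.y + a.y * b.x := rfl

instance : Ring (Triangular s) where
  add_assoc a b c := by ext <;> simp [add_assoc]
  zero_add a := by ext <;> simp
  add_zero a := by ext <;> simp
  add_comm a b := by ext <;> simp [add_comm]
  neg_add_cancel a := by ext <;> simp
  left_distrib a b c := by ext <;> simp [mul_add]; abel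
  right_distrib a b c := by ext <;> simp [add_mul]; abel
  zero_mul a := by ext <;> simp
  mul_zero a := by ext <;> simp
  mul_assoc a b c := by ext <;> simp [mul_add, add_mul, mul_assoc]; abel
  one_mul a := by ext <;> simp
  mul_one a := by ext <;> simp
  nsmul := nsmulRec
  zsmul := zsmulRec

end Triangular

end Twisted

variable (k A : Type u) [CommRing k] [CommRing A] [Algebra k A]

/-- The algebra `⨁ᵢ Ωⁱ` of differential forms of `A` over `k`. -/
abbrev Forms : Type u := ExteriorAlgebra A Ω[A⁄k]

variable {k A}

/-- The function `a`, seen as a form of degree `0`. -/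
abbrev fn (a : A) : Forms k A := algebraMap A (Forms k A) a

variable (k) in
/-- The exact form `da` of degree `1`. -/
abbrev dd (a : A) : Forms k A := ι A (KaehlerDifferential.D k A a)

theorem dd_add (a b : A) : dd k (a + b) = dd k a + dd k b := by
  simp [dd]

theorem dd_mul (a b : A) : dd k (a * b) = fn a * dd k b + fn b * dd k a := by
  simp only [dd, Derivation.leibniz, map_add, map_smul, Algebra.smul_def]

theorem dd_algebraMap (c : k) : dd k (algebraMap k A c) = 0 := by
  simp [dd]

@[elab_as_elim]
theorem Forms.induction {P : Forms k A → Prop} (hfn : ∀ a : A, P (fn a))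
    (hd : ∀ a : A, P (dd k a)) (hadd : ∀ x y, P x → P y → P (x + y))
    (hmul : ∀ x y, P x → P y → P (x * y)) (x : Forms k A) : P x := by
  induction x using ExteriorAlgebra.induction with
  | algebraMap a => exact hfn a
  | ι w =>
    have hw : w ∈ Submodule.span A (Set.range (KaehlerDifferential.D k A)) := by
      rw [KaehlerDifferential.span_range_derivation]; trivial
    induction hw using Submodule.span_induction with
    | mem w hw => obtain ⟨a, rfl⟩ := hw; exact hd a
    | zero => simpa using hfn 0
    | add v w _ _ hv hw => rw [map_add]; exact hadd _ _ hv hw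
    | smul a w _ hw => rw [map_smul, Algebra.smul_def]; exact hmul _ _ (hfn a) hw
  | mul x y hx hy => exact hmul x y hx hy
  | add x y hx hy => exact hadd x y hx hy

theorem ι_mul_comm (w : Ω[A⁄k]) (x : Forms k A) : ι A w * x = involute x * ι A w := by
  induction x using ExteriorAlgebra.induction with
  | algebraMap a =>
    rw [AlgHom.commutes]; exact (Algebra.commutes a _).symm
  | ι v =>
    rw [CliffordAlgebra.involute_ι, neg_mul, eq_neg_iff_add_eq_zero]
    exact ExteriorAlgebra.ι_add_mul_swap w v
  | mul x y hx hy => rw [map_mul, ← mul_assoc, hx, mul_assoc, hy, mul_assoc]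
  | add x y hx hy => rw [map_add, mul_add, add_mul, hx, hy]

/-- The ring in which the de Rham differential is the off-diagonal entry of a homomorphism. -/
abbrev Tw (k A : Type u) [CommRing k] [CommRing A] [Algebra k A] : Type u :=
  Triangular ((involute : Forms k A →ₐ[A] Forms k A) : Forms k A →+* Forms k A)

namespace Tw

/-- A function `a` acts by the matrix with diagonal `a` and upper right entry `da`. -/
def ofFn : A →+* Tw k A where
  toFun a := ⟨fn a, dd k a⟩
  map_one' := by ext <;> simp
  map_zero' := by ext <;> simp
  map_add' a b := by
    ext
    · simp
    · simpa using dd_add a b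
  map_mul' a b := by
    ext
    · simp
    · simp only [Triangular.mul_y, RingHom.coe_coe, AlgHom.commutes, dd_mul]
      rw [Algebra.commutes b]

instance : Algebra A (Tw k A) :=
  ofFn.toAlgebra' fun a z => by
    ext
    · exact Algebra.commutes _ _
    · simp only [ofFn, RingHom.coe_mk, MonoidHom.coe_mk, OneHom.coe_mk, Triangular.mul_y,
        RingHom.coe_coe, AlgHom.commutes]
      rw [ι_mul_comm, Algebra.commutes, add_comm]

instance : Module k (Tw k A) := Module.compHom _ (algebraMap k A)

instance : IsScalarTower k A (Tw k A) where
  smul_assoc c a z := by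
    change (c • a) • z = (algebraMap k A c) • (a • z)
    rw [← mul_smul, ← Algebra.smul_def]

theorem algebraMap_eq (a : A) : algebraMap A (Tw k A) a = ⟨fn a, dd k a⟩ := rfl

theorem smul_base (c : k) (z : Tw k A) : c • z = algebraMap A (Tw k A) (algebraMap k A c) * z :=
  Algebra.smul_def (algebraMap k A c) z

/-- The derivation `a ↦ da` into the off-diagonally twisted module. -/
def der : Derivation k A (Tw k A) :=
  Derivation.mk'
    { toFun := fun a => ⟨dd k a, 0⟩
      map_add' := fun a b => by
        ext
        · simpa using dd_add a b
        · simp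
      map_smul' := fun c a => by
        rw [RingHom.id_apply, smul_base, algebraMap_eq, dd_algebraMap]
        ext
        · rw [Triangular.mul_x, Algebra.smul_def, dd_mul, dd_algebraMap, mul_zero, add_zero]
        · simp }
    (fun a b => by
      simp only [Algebra.smul_def, algebraMap_eq, LinearMap.coe_mk, AddHom.coe_mk]
      ext
      · exact dd_mul a b
      · simp only [Triangular.add_y, Triangular.mul_y, mul_zero, zero_add]
        exact (ExteriorAlgebra.ι_add_mul_swap _ _).symm)

/-- The linear map on one-forms with diagonal entry `w` and off-diagonal entry `dw`. -/
def lin : Ω[A⁄k] →ₗ[A] Tw k A := der.liftKaehlerDifferential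

theorem lin_D (a : A) : lin (KaehlerDifferential.D k A a) = ⟨dd k a, 0⟩ :=
  Derivation.liftKaehlerDifferential_comp_D _ _

theorem lin_spec (w : Ω[A⁄k]) : (lin w).x = ι A w ∧ involute (lin w).y = (lin w).y := by
  have hw : w ∈ Submodule.span A (Set.range (KaehlerDifferential.D k A)) := by
    rw [KaehlerDifferential.span_range_derivation]; trivial
  induction hw using Submodule.span_induction with
  | mem w hw => obtain ⟨a, rfl⟩ := hw; simp [lin_D]
  | zero => simp
  | add v w _ _ hv hw => simp [hv.1, hv.2, hw.1, hw.2]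
  | smul a w _ hw =>
    rw [LinearMap.map_smul, LinearMap.map_smul, Algebra.smul_def, algebraMap_eq, Algebra.smul_def]
    simp [hw.1, hw.2]

theorem lin_sq (w : Ω[A⁄k]) : lin w * lin w = 0 := by
  ext
  · simp [(lin_spec w).1]
  · have h := ι_mul_comm w (lin w).y
    rw [(lin_spec w).2] at h
    simp [(lin_spec w).1, h]

/-- The algebra homomorphism `w ↦ (w, dw)`. -/
def hom : Forms k A →ₐ[A] Tw k A := ExteriorAlgebra.lift A ⟨lin, lin_sq⟩

theorem hom_fn (a : A) : hom (fn (k := k) a) = ⟨fn a, dd k a⟩ := hom.commutes a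

theorem hom_ι (w : Ω[A⁄k]) : hom (ι A w) = lin w := by
  simp [hom]

theorem hom_x (w : Forms k A) : (hom w).x = w := by
  induction w using Forms.induction with
  | hfn a => rw [hom_fn]
  | hd a => rw [hom_ι, lin_D]
  | hadd x y hx hy => simp [hx, hy]
  | hmul x y hx hy => simp [hx, hy]

end Tw

/-- The de Rham differential: the additive map with `d(a) = da`, `d(da) = 0` and
`d(v ∧ w) = dv ∧ w + (-1)^{deg v} v ∧ dw`. -/
def d : Forms k A →+ Forms k A where
  toFun w := (Tw.hom w).y
  map_zero' := by simp
  map_add' v w := by simp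

@[simp] theorem d_fn (a : A) : d (fn (k := k) a) = dd k a := congrArg Triangular.y (Tw.hom_fn a)

@[simp] theorem d_dd (a : A) : d (dd k a) = 0 := by simp [d, Tw.hom_ι, Tw.lin_D]

theorem d_mul (v w : Forms k A) : d (v * w) = involute v * d w + d v * w := by
  simp [d, Tw.hom_x]

theorem d_involute (w : Forms k A) : d (involute w) = -involute (d w) := by
  induction w using Forms.induction with
  | hfn a => simp
  | hd a => simp
  | hadd x y hx hy => simp [hx, hy, add_comm]
  | hmul x y hx hy => simp [d_mul, hx, hy, add_comm]

theorem d_d (w : Forms k A) : d (d w) = 0 := by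
  induction w using Forms.induction with
  | hfn a => simp
  | hd a => simp
  | hadd x y hx hy => simp [hx, hy]
  | hmul x y hx hy => simp [d_mul, hx, hy, d_involute]

theorem d_mem {i : ℕ} {w : Forms k A} (hw : w ∈ ⋀[A]^i Ω[A⁄k]) : d w ∈ ⋀[A]^(i + 1) Ω[A⁄k] := by
  have h2 (v : Ω[A⁄k]) : d (ι A v) ∈ ⋀[A]^2 Ω[A⁄k] := by
    have hv : v ∈ Submodule.span A (Set.range (KaehlerDifferential.D k A)) := by
      rw [KaehlerDifferential.span_range_derivation]; trivial
    induction hv using Submodule.span_induction with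
    | mem w hw => obtain ⟨a, rfl⟩ := hw; simp
    | zero => simp
    | add v w _ _ hv hw => simpa using add_mem hv hw
    | smul a w _ hw =>
      rw [map_smul, Algebra.smul_def, d_mul, d_fn, AlgHom.commutes, ← Algebra.smul_def]
      refine add_mem (Submodule.smul_mem _ _ hw) ?_
      rw [ExteriorAlgebra.exteriorPower, pow_two]
      exact Submodule.mul_mem_mul ⟨_, rfl⟩ ⟨_, rfl⟩
  induction hw using Submodule.pow_induction_on_left' with
  | algebraMap a =>
    rw [d_fn, ExteriorAlgebra.exteriorPower, zero_add, pow_one]; exact ⟨_, rfl⟩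
  | add x y i _ _ hx hy => rw [map_add]; exact add_mem hx hy
  | mem_mul v hv i x hx ih =>
    obtain ⟨v, rfl⟩ := hv
    rw [d_mul]
    refine add_mem ?_ ?_
    · rw [CliffordAlgebra.involute_ι, neg_mul, ExteriorAlgebra.exteriorPower, pow_succ']
      exact neg_mem (Submodule.mul_mem_mul ⟨_, rfl⟩ ih)
    · rw [ExteriorAlgebra.exteriorPower, show i.succ + 1 = 2 + i by omega, pow_add]
      exact Submodule.mul_mem_mul (h2 v) hx

section Functoriality

variable {B C : Type u} [CommRing B] [Algebra k B] [CommRing C] [Algebra k C]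

theorem exists_map (φ : A →ₐ[k] B) : ∃ f : Forms k A →+* Forms k B,
    (∀ a, f (fn a) = fn (φ a)) ∧ ∀ a, f (dd k a) = dd k (φ a) := by
  let _ : Algebra A (Forms k B) := Algebra.compHom _ φ.toRingHom
  have smul_eq (a : A) (w : Forms k B) : a • w = fn (φ a) * w := Algebra.smul_def (φ a) w
  have smul_eq' (c : k) (w : Forms k B) : c • w = fn (algebraMap k B c) * w :=
    Algebra.smul_def c w
  have : IsScalarTower k A (Forms k B) := ⟨fun c a w => by
    rw [smul_eq, smul_eq', smul_eq, Algebra.smul_def, map_mul, AlgHom.commutes, ← mul_assoc]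
    exact congrArg (· * w) (map_mul (algebraMap B (Forms k B)) _ _)⟩
  let der : Derivation k A (Forms k B) :=
    Derivation.mk'
      { toFun := fun a => dd k (φ a)
        map_add' := fun a b => by rw [map_add, dd_add]
        map_smul' := fun c a => by
          rw [map_smul, RingHom.id_apply, Algebra.smul_def, dd_mul, dd_algebraMap, mul_zero,
            add_zero, smul_eq'] }
      (fun a b => by
        simp only [LinearMap.coe_mk, AddHom.coe_mk]
        rw [smul_eq, smul_eq, map_mul, dd_mul])
  have hder : ∀ w : Ω[A⁄k], ∃ v, der.liftKaehlerDifferential w = ι B v := fun w => by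
    have hw : w ∈ Submodule.span A (Set.range (KaehlerDifferential.D k A)) := by
      rw [KaehlerDifferential.span_range_derivation]; trivial
    induction hw using Submodule.span_induction with
    | mem w hw =>
      obtain ⟨a, rfl⟩ := hw
      exact ⟨KaehlerDifferential.D k B (φ a), Derivation.liftKaehlerDifferential_comp_D _ _⟩
    | zero => exact ⟨0, by simp⟩
    | add v w _ _ hv hw =>
      obtain ⟨v', hv⟩ := hv
      obtain ⟨w', hw⟩ := hw
      exact ⟨v' + w', by rw [map_add, hv, hw, map_add]⟩
    | smul a w _ hw =>
      obtain ⟨w', hw⟩ := hw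
      exact ⟨φ a • w', by
        rw [LinearMap.map_smul, hw, smul_eq, LinearMap.map_smul, Algebra.smul_def]⟩
  let f : Forms k A →ₐ[A] Forms k B := ExteriorAlgebra.lift A
    ⟨der.liftKaehlerDifferential, fun w => by
      obtain ⟨v, hv⟩ := hder w
      rw [hv, ExteriorAlgebra.ι_sq_zero]⟩
  exact ⟨f.toRingHom, fun a => f.commutes a, fun a => (ExteriorAlgebra.lift_ι_apply A _ _ _).trans
    (Derivation.liftKaehlerDifferential_comp_D _ _)⟩

/-- Pull-back of differential forms along a homomorphism `φ` of algebras: the unique ring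
homomorphism that sends `a` to `φ a` and `da` to `d(φ a)`. -/
def map (φ : A →ₐ[k] B) : Forms k A →+* Forms k B := (exists_map φ).choose

@[simp] theorem map_fn (φ : A →ₐ[k] B) (a : A) : map φ (fn a) = fn (φ a) :=
  (exists_map φ).choose_spec.1 a

@[simp] theorem map_dd (φ : A →ₐ[k] B) (a : A) : map φ (dd k a) = dd k (φ a) :=
  (exists_map φ).choose_spec.2 a

theorem map_id (w : Forms k A) : map (AlgHom.id k A) w = w := by
  induction w using Forms.induction with
  | hfn a => simp
  | hd a => simp
  | hadd x y hx hy => simp [hx, hy]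
  | hmul x y hx hy => simp [hx, hy]

theorem map_map (ψ : B →ₐ[k] C) (φ : A →ₐ[k] B) (w : Forms k A) :
    map ψ (map φ w) = map (ψ.comp φ) w := by
  induction w using Forms.induction with
  | hfn a => simp
  | hd a => simp
  | hadd x y hx hy => simp [hx, hy]
  | hmul x y hx hy => simp [hx, hy]

theorem map_involute (φ : A →ₐ[k] B) (w : Forms k A) :
    map φ (involute w) = involute (map φ w) := by
  induction w using Forms.induction with
  | hfn a => simp
  | hd a => simp
  | hadd x y hx hy => simp [hx, hy]
  | hmul x y hx hy => simp [hx, hy]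

theorem map_d (φ : A →ₐ[k] B) (w : Forms k A) : map φ (d w) = d (map φ w) := by
  induction w using Forms.induction with
  | hfn a => simp
  | hd a => simp
  | hadd x y hx hy => simp [hx, hy]
  | hmul x y hx hy => simp [hx, hy, d_mul, map_involute]

theorem map_fn_smul (φ : A →ₐ[k] B) (a : A) (w : Forms k A) : map φ (a • w) = φ a • map φ w := by
  rw [Algebra.smul_def, map_mul, map_fn, Algebra.smul_def]

theorem map_mem (φ : A →ₐ[k] B) {i : ℕ} {w : Forms k A} (hw : w ∈ ⋀[A]^i Ω[A⁄k]) :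
    map φ w ∈ ⋀[B]^i Ω[B⁄k] := by
  have h1 (v : Ω[A⁄k]) : map φ (ι A v) ∈ LinearMap.range (ι B : Ω[B⁄k] →ₗ[B] _) := by
    have hv : v ∈ Submodule.span A (Set.range (KaehlerDifferential.D k A)) := by
      rw [KaehlerDifferential.span_range_derivation]; trivial
    induction hv using Submodule.span_induction with
    | mem w hw => obtain ⟨a, rfl⟩ := hw; exact ⟨_, (map_dd φ a).symm⟩
    | zero => simp
    | add v w _ _ hv hw => simpa using add_mem hv hw
    | smul a w _ hw =>
      rw [LinearMap.map_smul, map_fn_smul]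
      exact Submodule.smul_mem _ _ hw
  induction hw using Submodule.pow_induction_on_left' with
  | algebraMap a =>
    rw [ExteriorAlgebra.exteriorPower, pow_zero]
    exact ⟨φ a, by simp [Algebra.smul_def]⟩
  | add x y i _ _ hx hy => rw [map_add]; exact add_mem hx hy
  | mem_mul v hv i x hx ih =>
    obtain ⟨v, rfl⟩ := hv
    rw [map_mul, ExteriorAlgebra.exteriorPower, pow_succ']
    exact Submodule.mul_mem_mul (h1 v) ih

end Functoriality

/-! ### The inverse Cartier operator of an algebra -/

section Cartier

theorem natCast_eq_zero (k A : Type*) [CommRing k] [CommRing A] [Algebra k A] (p : ℕ) [CharP k p] :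
    (p : A) = 0 := by
  rw [← map_natCast (algebraMap k A), CharP.cast_eq_zero, map_zero]

variable (k A) in
/-- The ring of closed forms. -/
def Closed : Subring (Forms k A) where
  carrier := {w | d w = 0}
  zero_mem' := map_zero d
  one_mem' := by
    have h := d_fn (k := k) (1 : A)
    rw [fn, map_one] at h
    rw [Set.mem_ofPred_eq, h, ← map_one (algebraMap k A), dd_algebraMap]
  add_mem' hx hy := by simp_all
  neg_mem' hx := by simp_all
  mul_mem' hx hy := by
    rw [Set.mem_ofPred_eq] at *
    rw [d_mul, hx, hy, mul_zero, zero_mul, add_zero]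

theorem mem_Closed {w : Forms k A} : w ∈ Closed k A ↔ d w = 0 := Iff.rfl

variable (k A) in
/-- The two-sided ideal of exact forms in the ring of closed forms. -/
def Exact : Ideal (Closed k A) where
  carrier := {w | ∃ v : Forms k A, d v = (w : Forms k A)}
  zero_mem' := ⟨0, map_zero d⟩
  add_mem' := by
    rintro x y ⟨v, hv⟩ ⟨w, hw⟩
    exact ⟨v + w, by rw [map_add, hv, hw, Subring.coe_add]⟩
  smul_mem' := by
    rintro z w ⟨v, hv⟩
    have hz : d (z : Forms k A) = 0 := z.2
    refine ⟨involute (z : Forms k A) * v, ?_⟩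
    rw [d_mul, CliffordAlgebra.involute_involute, d_involute, hz, hv, map_zero, neg_zero, zero_mul,
      add_zero, smul_eq_mul, Subring.coe_mul]

instance : (Exact k A).IsTwoSided := ⟨by
  rintro w z ⟨v, hv⟩
  have hz : d (z : Forms k A) = 0 := z.2
  refine ⟨v * z, ?_⟩
  rw [d_mul, hz, hv, mul_zero, zero_add, Subring.coe_mul]⟩

variable (p : ℕ)

variable (k A) in
/-- The de Rham cohomology ring `⨁ᵢ Hⁱ`, regarded as an algebra over `A` through the Frobenius:
`a` acts as multiplication by `aᵖ`. -/
def Coh (_ : ℕ) : Type u := Closed k A ⧸ Exact k A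

instance : Ring (Coh k A p) := inferInstanceAs (Ring (Closed k A ⧸ Exact k A))

/-- The cohomology class of a closed form. -/
def cls : Closed k A →+* Coh k A p := Ideal.Quotient.mk (Exact k A)

theorem cls_eq_iff (v w : Closed k A) :
    cls p v = cls p w ↔ ∃ u : Forms k A, d u = (v : Forms k A) - (w : Forms k A) :=
  (Ideal.Quotient.eq (I := Exact k A) (x := v) (y := w) :)

theorem cls_surjective : Function.Surjective (cls p : Closed k A → Coh k A p) :=
  Ideal.Quotient.mk_surjective

variable [hp : Fact p.Prime]

/-- The Frobenius endomorphism of a ring in which `p = 0` (possibly the zero ring). -/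
def frob (R : Type*) [CommRing R] (h : (p : R) = 0) : R →+* R where
  toFun a := a ^ p
  map_one' := one_pow p
  map_zero' := zero_pow hp.out.ne_zero
  map_mul' a b := mul_pow a b p
  map_add' a b := by
    rw [add_pow_prime_eq hp.out, h]; simp

variable [CharP k p]

theorem dd_pow (a : A) (n : ℕ) : dd k (a ^ n) = fn (n * a ^ (n - 1)) * dd k a := by
  rw [dd, Derivation.leibniz_pow, ← Nat.cast_smul_eq_nsmul A, smul_smul, LinearMap.map_smul,
    Algebra.smul_def]

theorem d_fn_pow_mul (a : A) (w : Forms k A) : d (fn (a ^ p) * w) = fn (a ^ p) * d w := by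
  rw [d_mul, d_fn, dd_pow, natCast_eq_zero k A p]
  simp

theorem d_pow_smul (a : A) (w : Forms k A) : d (a ^ p • w) = a ^ p • d w := by
  rw [Algebra.smul_def, Algebra.smul_def]
  exact d_fn_pow_mul p _ _

variable (k A) in
/-- The ring homomorphism `a ↦ aᵖ` to closed forms. -/
def frobClosed : A →+* Closed k A :=
  ((algebraMap A (Forms k A)).comp (frob p A (natCast_eq_zero k A p))).codRestrict (Closed k A)
    fun a => by
      rw [mem_Closed, RingHom.comp_apply, d_fn]
      change dd k (a ^ p) = 0
      rw [dd_pow, natCast_eq_zero k A p]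
      simp

theorem coe_frobClosed (a : A) : (frobClosed k A p a : Forms k A) = fn (a ^ p) := rfl

instance : Algebra A (Coh k A p) :=
  ((cls p).comp (frobClosed k A p)).toAlgebra' fun a z => by
    obtain ⟨z, rfl⟩ := cls_surjective p z
    rw [RingHom.comp_apply, ← map_mul, ← map_mul]
    refine congrArg (cls p) (Subtype.ext ?_)
    exact Algebra.commutes (R := A) (A := Forms k A) (a ^ p) z

theorem algebraMap_Coh (a : A) : algebraMap A (Coh k A p) a = cls p (frobClosed k A p a) := rfl

instance : Module k (Coh k A p) := Module.compHom _ (algebraMap k A)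

instance : IsScalarTower k A (Coh k A p) where
  smul_assoc c a z := by
    change (c • a) • z = (algebraMap k A c) • (a • z)
    rw [← mul_smul, ← Algebra.smul_def]

theorem Coh_smul_base (c : k) (z : Coh k A p) :
    c • z = algebraMap A (Coh k A p) (algebraMap k A c) * z :=
  Algebra.smul_def (algebraMap k A c) z

/-- The closed form `aᵖ⁻¹ da`. -/
def logForm (a : A) : Closed k A :=
  ⟨fn (a ^ (p - 1)) * dd k a, by
    rw [mem_Closed, d_mul, d_dd, d_fn, dd_pow, mul_zero, zero_add, mul_assoc,
      ExteriorAlgebra.ι_sq_zero, mul_zero]⟩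

theorem fn_mul_fn_mul (a b : A) (w : Forms k A) : fn a * (fn b * w) = fn (a * b) * w := by
  rw [← mul_assoc, ← map_mul]

theorem logForm_add (a b : A) :
    cls p (logForm p (a + b) : Closed k A) = cls p (logForm p a) + cls p (logForm p b) := by
  rw [← map_add, cls_eq_iff]
  obtain ⟨q, rfl⟩ : ∃ q, p = q + 1 := ⟨p - 1, (Nat.sub_add_cancel hp.out.one_le).symm⟩
  let c (j : ℕ) : ℕ := (q + 1).choose (j + 1) / (q + 1)
  have hc (j : ℕ) (hj : j < q) : c j * (q + 1) = (q + 1).choose (j + 1) :=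
    Nat.div_mul_cancel (hp.out.dvd_choose_self (by omega) (by omega))
  have hc1 (j : ℕ) (hj : j < q) : c j * (j + 1) = q.choose j := by
    refine Nat.eq_of_mul_eq_mul_right (Nat.succ_pos q) ?_
    have h1 := hc j hj
    have h2 := Nat.add_one_mul_choose_eq q j
    simp only [Nat.succ_eq_add_one] at h2 ⊢
    rw [mul_right_comm, h1]
    linarith
  have hc2 (j : ℕ) (hj : j < q) : c j * (q - j) = q.choose (j + 1) := by
    refine Nat.eq_of_mul_eq_mul_right (Nat.succ_pos j) ?_
    rw [mul_right_comm, Nat.succ_eq_add_one, hc1 j hj, Nat.choose_succ_right_eq]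
  have hd (m n : ℕ) (x y : A) : dd k (x ^ m * y ^ n) =
      fn (m * (x ^ (m - 1) * y ^ n)) * dd k x + fn (n * (x ^ m * y ^ (n - 1))) * dd k y := by
    rw [dd_mul, dd_pow, dd_pow, ← mul_assoc, ← mul_assoc, ← map_mul, ← map_mul]
    rw [show x ^ m * (n * y ^ (n - 1)) = n * (x ^ m * y ^ (n - 1)) by ring,
      show y ^ n * (m * x ^ (m - 1)) = m * (x ^ (m - 1) * y ^ n) by ring, add_comm]
  refine ⟨fn (∑ j ∈ Finset.range q, (c j : A) * (a ^ (j + 1) * b ^ (q - j))), ?_⟩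
  have hterm (j : ℕ) (hj : j ∈ Finset.range q) :
      d (fn (k := k) ((c j : A) * (a ^ (j + 1) * b ^ (q - j)))) =
        fn (a ^ j * b ^ (q - j) * (q.choose j : A)) * dd k a +
        fn (a ^ (j + 1) * b ^ (q - (j + 1)) * (q.choose (j + 1) : A)) * dd k b := by
    have hj' := Finset.mem_range.mp hj
    rw [d_fn, dd_mul, hd, ← hc1 j hj', ← hc2 j hj', ← map_natCast (algebraMap k A),
      dd_algebraMap, mul_zero, add_zero, mul_add, fn_mul_fn_mul, fn_mul_fn_mul,
      map_natCast, Nat.add_sub_cancel, Nat.sub_sub]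
    congr 3
    · push_cast; ring
    · push_cast; ring
  have hsum : d (fn (k := k) (∑ j ∈ Finset.range q, (c j : A) * (a ^ (j + 1) * b ^ (q - j)))) =
      fn (∑ j ∈ Finset.range q, a ^ j * b ^ (q - j) * (q.choose j : A)) * dd k a +
      fn (∑ j ∈ Finset.range q, a ^ (j + 1) * b ^ (q - (j + 1)) * (q.choose (j + 1) : A)) *
        dd k b := by
    rw [fn, map_sum, map_sum, Finset.sum_congr rfl hterm, Finset.sum_add_distrib, fn, fn, map_sum,
      map_sum, Finset.sum_mul, Finset.sum_mul]
  have e1 : ∑ j ∈ Finset.range q, a ^ j * b ^ (q - j) * (q.choose j : A) =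
      (a + b) ^ q - a ^ q := by
    rw [add_pow, Finset.sum_range_succ]; simp
  have e2 : ∑ j ∈ Finset.range q, a ^ (j + 1) * b ^ (q - (j + 1)) * (q.choose (j + 1) : A) =
      (a + b) ^ q - b ^ q := by
    rw [add_pow, Finset.sum_range_succ']; simp
  rw [hsum, e1, e2]
  simp only [logForm, Nat.add_sub_cancel, Subring.coe_add, dd_add]
  simp only [fn, map_sub, sub_mul, mul_add]
  abel

theorem logForm_mul (a b : A) : (logForm p (a * b) : Closed k A) =
    frobClosed k A p a * logForm p b + frobClosed k A p b * logForm p a := by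
  ext
  have h (x : A) : x ^ p = x ^ (p - 1) * x := by
    rw [← pow_succ, Nat.sub_add_cancel hp.out.one_le]
  simp only [logForm, Subring.coe_add, Subring.coe_mul, coe_frobClosed, mul_pow, dd_mul, mul_add,
    ← mul_assoc, ← map_mul]
  congr 3
  · rw [h a]; ring
  · rw [h b]; ring

theorem logForm_algebraMap (c : k) : (logForm p (algebraMap k A c) : Closed k A) = 0 := by
  ext
  simp [logForm, dd_algebraMap]

/-- The derivation `a ↦ [aᵖ⁻¹ da]`. -/
def logDer : Derivation k A (Coh k A p) :=
  Derivation.mk'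
    { toFun := fun a => cls p (logForm p a)
      map_add' := logForm_add p
      map_smul' := fun c a => by
        rw [RingHom.id_apply, Coh_smul_base, Algebra.smul_def c a, logForm_mul, logForm_algebraMap, mul_zero, add_zero,
          map_mul, algebraMap_Coh] }
    (fun a b => by
      simp only [LinearMap.coe_mk, AddHom.coe_mk]
      rw [logForm_mul, map_add, map_mul, map_mul, Algebra.smul_def, Algebra.smul_def,
        algebraMap_Coh, algebraMap_Coh])

theorem logDer_lift (w : Ω[A⁄k]) : ∃ z : Closed k A, (z : Forms k A) ∈ LinearMap.range (ι A) ∧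
    (logDer p).liftKaehlerDifferential w = cls p z := by
  have hw : w ∈ Submodule.span A (Set.range (KaehlerDifferential.D k A)) := by
    rw [KaehlerDifferential.span_range_derivation]; trivial
  induction hw using Submodule.span_induction with
  | mem w hw =>
    obtain ⟨a, rfl⟩ := hw
    refine ⟨logForm p a, ⟨a ^ (p - 1) • KaehlerDifferential.D k A a, ?_⟩,
      Derivation.liftKaehlerDifferential_comp_D _ _⟩
    rw [LinearMap.map_smul, Algebra.smul_def, logForm]
  | zero => exact ⟨0, by simp, by simp⟩
  | add v w _ _ hv hw =>
    obtain ⟨v', hv1, hv2⟩ := hv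
    obtain ⟨w', hw1, hw2⟩ := hw
    exact ⟨v' + w', add_mem hv1 hw1, by rw [map_add, hv2, hw2, map_add]⟩
  | smul a w _ hw =>
    obtain ⟨z, ⟨v, hv⟩, hz⟩ := hw
    refine ⟨frobClosed k A p a * z, ⟨a ^ p • v, ?_⟩, ?_⟩
    · rw [LinearMap.map_smul, Algebra.smul_def, hv]; rfl
    · rw [LinearMap.map_smul, hz, Algebra.smul_def, algebraMap_Coh, map_mul]

/-- The total inverse Cartier operator: the homomorphism of algebras from forms to de Rham
cohomology that sends `a` to `[aᵖ]` and `da` to `[aᵖ⁻¹ da]`. -/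
def invCartierHom : Forms k A →ₐ[A] Coh k A p :=
  ExteriorAlgebra.lift A ⟨(logDer p).liftKaehlerDifferential, fun w => by
    obtain ⟨z, ⟨v, hv⟩, hz⟩ := logDer_lift p w
    rw [hz, ← map_mul, show z * z = 0 by ext; simp [← hv], map_zero]⟩

theorem invCartierHom_fn (a : A) :
    invCartierHom p (fn (k := k) a) = cls p (frobClosed k A p a) :=
  (invCartierHom p).commutes a

theorem invCartierHom_dd (a : A) : invCartierHom p (dd k a) = cls p (logForm p a) :=
  (ExteriorAlgebra.lift_ι_apply A _ _ _).trans (Derivation.liftKaehlerDifferential_comp_D _ _)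

theorem exists_invCartierHom_eq {i : ℕ} {w : Forms k A} (hw : w ∈ ⋀[A]^i Ω[A⁄k]) :
    ∃ z : Closed k A, (z : Forms k A) ∈ ⋀[A]^i Ω[A⁄k] ∧ invCartierHom p w = cls p z := by
  induction hw using Submodule.pow_induction_on_left' with
  | algebraMap a =>
    refine ⟨frobClosed k A p a, ?_, invCartierHom_fn p a⟩
    rw [ExteriorAlgebra.exteriorPower, pow_zero]
    exact ⟨a ^ p, by simp [Algebra.smul_def, coe_frobClosed]⟩
  | add x y i _ _ hx hy =>
    obtain ⟨v', hv1, hv2⟩ := hx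
    obtain ⟨w', hw1, hw2⟩ := hy
    exact ⟨v' + w', add_mem hv1 hw1, by rw [map_add, hv2, hw2, map_add]⟩
  | mem_mul v hv i x hx ih =>
    obtain ⟨v, rfl⟩ := hv
    obtain ⟨x', hx1, hx2⟩ := ih
    obtain ⟨z, hz1, hz2⟩ := logDer_lift p v
    refine ⟨z * x', ?_, ?_⟩
    · rw [ExteriorAlgebra.exteriorPower, pow_succ', Subring.coe_mul]
      exact Submodule.mul_mem_mul hz1 hx1
    · rw [map_mul, hx2, map_mul, ← hz2]
      congr 1
      exact ExteriorAlgebra.lift_ι_apply A _ _ _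

theorem exists_closed (w : Forms k A) : ∃ z : Closed k A, invCartierHom p w = cls p z :=
  (cls_surjective p (invCartierHom p w)).imp fun _ h => h.symm

theorem invCartierHom_map {B : Type u} [CommRing B] [Algebra k B] (φ : A →ₐ[k] B)
    (w : Forms k A) (z : Closed k A) (z' : Closed k B) (hz' : (z' : Forms k B) = map φ z)
    (h : invCartierHom p w = cls p z) : invCartierHom p (map φ w) = cls p z' := by
  suffices H : ∃ (z : Closed k A) (z' : Closed k B), (z' : Forms k B) = map φ z ∧
      invCartierHom p w = cls p z ∧ invCartierHom p (map φ w) = cls p z' by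
    obtain ⟨y, y', hy', h1, h2⟩ := H
    rw [h2]
    rw [h1, cls_eq_iff] at h
    obtain ⟨u, hu⟩ := h
    rw [cls_eq_iff]
    exact ⟨map φ u, by rw [← map_d, hu, map_sub, hz', hy']⟩
  clear h
  induction w using Forms.induction with
  | hfn a =>
    refine ⟨_, _, ?_, invCartierHom_fn p a, by rw [map_fn]; exact invCartierHom_fn p (φ a)⟩
    rw [coe_frobClosed, coe_frobClosed, map_fn, map_pow]
  | hd a =>
    refine ⟨_, _, ?_, invCartierHom_dd p a, by rw [map_dd]; exact invCartierHom_dd p (φ a)⟩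
    simp [logForm]
  | hadd x y hx hy =>
    obtain ⟨z₁, z₁', h₁, h₁', h₁''⟩ := hx
    obtain ⟨z₂, z₂', h₂, h₂', h₂''⟩ := hy
    exact ⟨z₁ + z₂, z₁' + z₂', by simp [h₁, h₂], by simp [h₁', h₂'], by simp [h₁'', h₂'']⟩
  | hmul x y hx hy =>
    obtain ⟨z₁, z₁', h₁, h₁', h₁''⟩ := hx
    obtain ⟨z₂, z₂', h₂, h₂', h₂''⟩ := hy
    exact ⟨z₁ * z₂, z₁' * z₂', by simp [h₁, h₂], by simp [h₁', h₂'], by simp [h₁'', h₂'']⟩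

end Cartier

/-! ### The homogeneous parts -/

variable (k A) in
/-- The differential forms of degree `i` of `A` over `k`. -/
abbrev Ωdeg (i : ℕ) : Type u := ⋀[A]^i Ω[A⁄k]

/-- Pull-back of forms of degree `i`. -/
def mapDeg {B : Type u} [CommRing B] [Algebra k B] (φ : A →ₐ[k] B) (i : ℕ) :
    Ωdeg k A i →+ Ωdeg k B i where
  toFun w := ⟨map φ w, map_mem φ w.2⟩
  map_zero' := by ext; simp
  map_add' v w := by ext; simp

theorem coe_mapDeg {B : Type u} [CommRing B] [Algebra k B] (φ : A →ₐ[k] B) {i : ℕ}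
    (w : Ωdeg k A i) : (mapDeg φ i w : Forms k B) = map φ w := rfl

/-- The de Rham differential in degree `i`. -/
def dDeg (i : ℕ) : Ωdeg k A i →+ Ωdeg k A (i + 1) where
  toFun w := ⟨d w, d_mem w.2⟩
  map_zero' := by ext; simp
  map_add' v w := by ext; simp

theorem coe_dDeg {i : ℕ} (w : Ωdeg k A i) : (dDeg i w : Forms k A) = d w := rfl

variable (k A) in
/-- The group of closed forms of degree `i`. -/
def ZDeg (i : ℕ) : AddSubgroup (Ωdeg k A i) := (dDeg i).ker

variable (k A) in
/-- The group of exact forms of degree `i`. -/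
def BDeg : (i : ℕ) → AddSubgroup (Ωdeg k A i)
  | 0 => ⊥
  | i + 1 => (dDeg i).range

variable (k A) in
/-- The algebraic de Rham cohomology group of degree `i`. -/
abbrev HDeg (i : ℕ) : Type u := ZDeg k A i ⧸ (BDeg k A i).addSubgroupOf (ZDeg k A i)

theorem mem_BDeg {i : ℕ} (w : Ωdeg k A i) (u : Forms k A) (hu : d u = w) : w ∈ BDeg k A i := by
  classical
  let π (j : ℕ) (x : Forms k A) : Forms k A :=
    GradedRing.proj (fun i : ℕ => ⋀[A]^i Ω[A⁄k]) j x
  have hsame (j : ℕ) (x : Forms k A) (hx : x ∈ ⋀[A]^j Ω[A⁄k]) : π j x = x :=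
    DirectSum.decompose_of_mem_same (fun i : ℕ => ⋀[A]^i Ω[A⁄k]) hx
  have hne (j j' : ℕ) (x : Forms k A) (hx : x ∈ ⋀[A]^j Ω[A⁄k]) (h : j ≠ j') : π j' x = 0 :=
    DirectSum.decompose_of_mem_ne (fun i : ℕ => ⋀[A]^i Ω[A⁄k]) hx h
  have h0 (x : Forms k A) : π 0 (d x) = 0 := by
    refine DirectSum.Decomposition.inductionOn (fun i : ℕ => ⋀[A]^i Ω[A⁄k])
      (motive := fun x => π 0 (d x) = 0) ?_ ?_ ?_ x
    · simp [π]
    rotate_left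
    · intro x y hx hy
      simp only [π, map_add] at *; rw [hx, hy, add_zero]
    · intro m x
      exact hne (m + 1) 0 _ (d_mem x.2) (by omega)
  have hs (j : ℕ) (x : Forms k A) : π (j + 1) (d x) = d (π j x) := by
    refine DirectSum.Decomposition.inductionOn (fun i : ℕ => ⋀[A]^i Ω[A⁄k])
      (motive := fun x => π (j + 1) (d x) = d (π j x)) ?_ ?_ ?_ x
    · simp [π]
    rotate_left
    · intro x y hx hy
      simp only [π, map_add] at *; rw [hx, hy]
    · intro m x
      by_cases h : m = j
      · subst h
        rw [hsame _ _ (d_mem x.2), hsame _ _ x.2]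
      · rw [hne _ _ _ (d_mem x.2) (by omega), hne _ _ _ x.2 h, map_zero]
  cases i with
  | zero =>
    have h := h0 u
    rw [hu, hsame _ _ w.2] at h
    exact (AddSubgroup.mem_bot).mpr (Subtype.ext h)
  | succ i =>
    have h := hs i u
    rw [hu, hsame _ _ w.2] at h
    exact ⟨⟨π i u, SetLike.coe_mem _⟩, Subtype.ext h.symm⟩

section Cartier

variable (p : ℕ) [hp : Fact p.Prime] [CharP k p]

/-- The graph of the inverse Cartier operator in degree `i`: the class of the closed form `z` of
degree `i` is the value of the inverse Cartier operator at `w`. -/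
def InvCartierRel {i : ℕ} (w : Ωdeg k A i) (z : ZDeg k A i) : Prop :=
  ∃ h : ((z : Ωdeg k A i) : Forms k A) ∈ Closed k A,
    invCartierHom p (w : Forms k A) = cls p ⟨_, h⟩

theorem mem_closed {i : ℕ} (z : ZDeg k A i) : ((z : Ωdeg k A i) : Forms k A) ∈ Closed k A :=
  congrArg Subtype.val z.2

theorem invCartierRel_iff {i : ℕ} (w : Ωdeg k A i) (z : ZDeg k A i) :
    InvCartierRel p w z ↔ invCartierHom p (w : Forms k A) = cls p ⟨_, mem_closed z⟩ :=
  ⟨fun h => h.2, fun h => ⟨_, h⟩⟩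

theorem exists_invCartierRel {i : ℕ} (w : Ωdeg k A i) : ∃ z, InvCartierRel p w z := by
  obtain ⟨z, hz, h⟩ := exists_invCartierHom_eq p w.2
  exact ⟨⟨⟨z, hz⟩, Subtype.ext z.2⟩, z.2, h⟩

theorem InvCartierRel.sub_mem {i : ℕ} {w : Ωdeg k A i} {z z' : ZDeg k A i}
    (h : InvCartierRel p w z) (h' : InvCartierRel p w z') : (z : Ωdeg k A i) - z' ∈ BDeg k A i := by
  rw [invCartierRel_iff] at h h'
  obtain ⟨u, hu⟩ := (cls_eq_iff p _ _).mp (h.symm.trans h')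
  exact mem_BDeg _ u hu

theorem InvCartierRel.add {i : ℕ} {w w' : Ωdeg k A i} {z z' : ZDeg k A i}
    (h : InvCartierRel p w z) (h' : InvCartierRel p w' z') : InvCartierRel p (w + w') (z + z') := by
  rw [invCartierRel_iff] at h h' ⊢
  rw [Submodule.coe_add, map_add, h, h', ← map_add]
  rfl

/-- Pull-back of closed forms of degree `i`. -/
def mapZDeg {B : Type u} [CommRing B] [Algebra k B] (φ : A →ₐ[k] B) {i : ℕ} (z : ZDeg k A i) :
    ZDeg k B i :=
  ⟨mapDeg φ i z, Subtype.ext (by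
    have h : d ((z : Ωdeg k A i) : Forms k A) = 0 := mem_closed z
    change d (map φ ((z : Ωdeg k A i) : Forms k A)) = 0
    rw [← map_d, h, map_zero])⟩

/-- The product of a closed form of degree `i` with `aᵖ`. -/
def powSmulZDeg (a : A) {i : ℕ} (z : ZDeg k A i) : ZDeg k A i :=
  ⟨a ^ p • (z : Ωdeg k A i), Subtype.ext (by
    have h : d ((z : Ωdeg k A i) : Forms k A) = 0 := mem_closed z
    change d (a ^ p • ((z : Ωdeg k A i) : Forms k A)) = 0
    rw [d_pow_smul, h, smul_zero])⟩

theorem InvCartierRel.map {B : Type u} [CommRing B] [Algebra k B] (φ : A →ₐ[k] B) {i : ℕ}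
    {w : Ωdeg k A i} {z : ZDeg k A i} (h : InvCartierRel p w z) :
    InvCartierRel p (mapDeg φ i w) (mapZDeg φ z) := by
  rw [invCartierRel_iff] at h ⊢
  exact invCartierHom_map p φ _ _ _ rfl h

theorem InvCartierRel.smul (a : A) {i : ℕ} {w : Ωdeg k A i} {z : ZDeg k A i}
    (h : InvCartierRel p w z) : InvCartierRel p (a • w) (powSmulZDeg p a z) := by
  rw [invCartierRel_iff] at h ⊢
  rw [Submodule.coe_smul, _root_.map_smul, h, Algebra.smul_def, algebraMap_Coh, ← map_mul]
  refine congrArg (cls p) (Subtype.ext ?_)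
  exact (Algebra.smul_def (R := A) (A := Forms k A) (a ^ p) ((z : Ωdeg k A i) : Forms k A)).symm

/-- The inverse Cartier operator of an algebra in degree `i`, with values in the algebraic de Rham
cohomology: the additive map with
`a db₁ ∧ ⋯ ∧ dbᵢ ↦ [aᵖ (b₁ ⋯ bᵢ)ᵖ⁻¹ db₁ ∧ ⋯ ∧ dbᵢ]`. -/
def invCartier (i : ℕ) : Ωdeg k A i →+ HDeg k A i :=
  AddMonoidHom.mk' (fun w => QuotientAddGroup.mk (exists_invCartierRel p w).choose) fun v w => by
    rw [← QuotientAddGroup.mk_add, QuotientAddGroup.eq]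
    have h := (exists_invCartierRel p (v + w)).choose_spec
    have h' := (exists_invCartierRel p v).choose_spec.add p
      (exists_invCartierRel p w).choose_spec
    have h'' := InvCartierRel.sub_mem p h' h
    rw [AddSubgroup.mem_addSubgroupOf]
    rwa [sub_eq_neg_add] at h''

theorem invCartier_eq {i : ℕ} {w : Ωdeg k A i} {z : ZDeg k A i} (h : InvCartierRel p w z) :
    invCartier p i w = QuotientAddGroup.mk z := by
  change QuotientAddGroup.mk _ = _
  rw [QuotientAddGroup.eq, AddSubgroup.mem_addSubgroupOf]
  have h'' := InvCartierRel.sub_mem p h (exists_invCartierRel p w).choose_spec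
  rwa [sub_eq_neg_add] at h''

end Cartier

end DeRham

/-! ### The sheaves of differential forms on a scheme over a field -/

namespace DeRham

open TopologicalSpace Opposite Limits

section Sheaf

variable (k : Type u) [Field k] (X : Scheme.{u}) [X.Over (Spec (.of k))]

instance sectionAlgebra (U : X.Opens) : Algebra k Γ(X, U) :=
  ((Scheme.ΓSpecIso (.of k)).inv ≫ (X ↘ Spec (.of k)).appTop ≫
    X.presheaf.map (homOfLE le_top : U ⟶ ⊤).op).hom.toAlgebra

/-- The restriction maps of the structure sheaf, as homomorphisms of `k`-algebras. -/
def res {U V : X.Opensᵒᵖ} (f : U ⟶ V) : Γ(X, U.unop) →ₐ[k] Γ(X, V.unop) where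
  __ := (X.presheaf.map f).hom
  commutes' c := by
    change ((Scheme.ΓSpecIso (.of k)).inv ≫ (X ↘ Spec (.of k)).appTop ≫
      X.presheaf.map (homOfLE le_top : U.unop ⟶ ⊤).op ≫ X.presheaf.map f).hom c = _
    rw [← X.presheaf.map_comp]
    rfl

theorem res_apply {U V : X.Opensᵒᵖ} (f : U ⟶ V) (a : Γ(X, U.unop)) :
    res k X f a = X.presheaf.map f a := rfl

/-- The presheaf of abelian groups `U ↦ Ωⁱ(Γ(X, U)/k)`. -/
def formsAb (i : ℕ) : X.Opensᵒᵖ ⥤ Ab.{u} where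
  obj U := .of (Ωdeg k Γ(X, U.unop) i)
  map f := AddCommGrpCat.ofHom (mapDeg (res k X f) i)
  map_id U := by
    ext w
    have h : res k X (𝟙 U) = AlgHom.id k _ :=
      AlgHom.ext fun a => ConcreteCategory.congr_hom (X.presheaf.map_id U) a
    change map (res k X (𝟙 U)) (w : Forms k Γ(X, U.unop)) = w
    rw [h, map_id]
  map_comp {U V W} f g := by
    ext w
    have h : res k X (f ≫ g) = (res k X g).comp (res k X f) :=
      AlgHom.ext fun a => ConcreteCategory.congr_hom (X.presheaf.map_comp f g) a
    change map (res k X (f ≫ g)) (w : Forms k Γ(X, U.unop)) = map _ (map _ _)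
    rw [h, map_map]

instance (i : ℕ) (U : X.Opensᵒᵖ) : Module (X.ringCatSheaf.obj.obj U) ((formsAb k X i).obj U) :=
  inferInstanceAs (Module Γ(X, U.unop) (Ωdeg k Γ(X, U.unop) i))

/-- The presheaf of modules `U ↦ Ωⁱ(Γ(X, U)/k) = ⋀ⁱ Ω¹(Γ(X, U)/k)`. -/
def formsPre (i : ℕ) : X.PresheafOfModules :=
  PresheafOfModules.ofPresheaf (formsAb k X i) fun {U V} f r w => by
    refine Subtype.ext ?_
    exact map_fn_smul (res k X f) r (w : Ωdeg k Γ(X, U.unop) i).1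

/-- The sheaf `Ωⁱ` of differential forms of degree `i` on `X` over `k`: the sheaf of modules
associated with the presheaf `U ↦ ⋀ⁱ Ω¹(Γ(X, U)/k)`. -/
def Ω (i : ℕ) : X.Modules :=
  (PresheafOfModules.sheafification (𝟙 X.ringCatSheaf.obj)).obj (formsPre k X i)

/-- The canonical map from the presheaf of differential forms to its associated sheaf. -/
def toΩ (i : ℕ) : formsPre k X i ⟶ (Ω k X i).val :=
  PresheafOfModules.toSheafify (𝟙 X.ringCatSheaf.obj)
    (CategoryTheory.toSheafify (Opens.grothendieckTopology X) (formsPre k X i).presheaf)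

end Sheaf

section Frobenius

variable (p : ℕ) [hp : Fact p.Prime] (k : Type u) [Field k] [CharP k p]
  (X : Scheme.{u}) [X.Over (Spec (.of k))]

/-- The absolute Frobenius morphism of the underlying presheafed space of `X`: the identity on the
underlying space and `a ↦ aᵖ` on the structure sheaf. -/
def frobeniusPre : X.toPresheafedSpace.Hom X.toPresheafedSpace where
  base := 𝟙 _
  c := { app U := CommRingCat.ofHom (frob p Γ(X, U.unop) (natCast_eq_zero k _ p))
         naturality U V f := by
          ext a
          exact (map_pow (X.presheaf.map f).hom a p).symm }

/-- The absolute Frobenius morphism of `X`. -/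
def frobenius : X ⟶ X where
  __ := frobeniusPre p k X
  prop x := ⟨fun s hs => by
    obtain ⟨U, hxU, a, rfl⟩ := TopCat.Presheaf.exists_germ_eq X.presheaf (x := x) s
    have h := PresheafedSpace.stalkMap_germ_apply (frobeniusPre p k X) U x hxU a
    erw [h] at hs
    have h2 : X.presheaf.germ U x hxU (a ^ p) = (X.presheaf.germ U x hxU a) ^ p :=
      map_pow (X.presheaf.germ U x hxU).hom a p
    have h3 : IsUnit ((X.presheaf.germ U x hxU a) ^ p) := by
      rw [← h2]; exact hs
    exact (isUnit_pow_iff hp.out.ne_zero).mp h3⟩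

theorem frobenius_preimage (U : X.Opens) : (frobenius p k X) ⁻¹ᵁ U = U := rfl

theorem frobenius_app_apply (U : X.Opens) (a : Γ(X, U)) :
    (frobenius p k X).app U a = a ^ p := rfl


/-- Push-forward of presheaves of modules along the Frobenius. -/
abbrev Fpre : X.PresheafOfModules ⥤ X.PresheafOfModules :=
  PresheafOfModules.pushforward (frobenius p k X).toRingCatSheafHom.hom

instance {M N : X.PresheafOfModules} (f : M ⟶ N)
    [PresheafOfModules.IsLocallyInjective (Opens.grothendieckTopology X) f] :
    PresheafOfModules.IsLocallyInjective (Opens.grothendieckTopology X) ((Fpre p k X).map f) := by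
  refine ⟨fun {U} s t h => ?_⟩
  exact Presheaf.equalizerSieve_mem (Opens.grothendieckTopology X)
    ((PresheafOfModules.toPresheaf _).map f) (X := U) s t h

instance {M N : X.PresheafOfModules} (f : M ⟶ N)
    [PresheafOfModules.IsLocallySurjective (Opens.grothendieckTopology X) f] :
    PresheafOfModules.IsLocallySurjective (Opens.grothendieckTopology X) ((Fpre p k X).map f) := by
  refine ⟨fun {U} s => ?_⟩
  exact Presheaf.imageSieve_mem (Opens.grothendieckTopology X)
    ((PresheafOfModules.toPresheaf _).map f) (U := op U) s

/-- The presheaf of modules `U ↦ F_* Ωⁱ(Γ(X, U)/k)`. -/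
def FformsPre (i : ℕ) : X.PresheafOfModules :=
  (PresheafOfModules.pushforward (frobenius p k X).toRingCatSheafHom.hom).obj (formsPre k X i)

/-- The sheaf of modules `F_* Ωⁱ`. -/
abbrev FΩ (i : ℕ) : X.Modules := (Scheme.Modules.pushforward (frobenius p k X)).obj (Ω k X i)

/-- The canonical map from `U ↦ F_* Ωⁱ(Γ(X, U)/k)` to its associated sheaf `F_* Ωⁱ`. -/
def toFΩ (i : ℕ) : FformsPre p k X i ⟶ (FΩ p k X i).val :=
  (PresheafOfModules.pushforward (frobenius p k X).toRingCatSheafHom.hom).map (toΩ k X i)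


theorem comp_liftCycles_homologyπ_eq_zero {C : Type*} [Category C] [Abelian C]
    (K : CochainComplex C ℕ) (i : ℕ) {M N : C} (e : M ⟶ N) (f : N ⟶ K.X (i + 1))
    (hf : f ≫ K.d (i + 1) (i + 1 + 1) = 0) (x : M ⟶ K.X i) (h : e ≫ f = x ≫ K.d i (i + 1)) :
    e ≫ K.liftCycles f (i + 1 + 1) (by simp) hf ≫ K.homologyπ (i + 1) = 0 := by
  rw [← Category.assoc, HomologicalComplex.comp_liftCycles]
  exact K.liftCycles_homologyπ_eq_zero_of_boundary _ _ _ x h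

section Descend

variable {X}

/-- The canonical map from a presheaf of modules to its associated sheaf of modules. -/
def toShf (P : X.PresheafOfModules) :
    P ⟶ ((PresheafOfModules.sheafification (𝟙 X.ringCatSheaf.obj)).obj P).val :=
  PresheafOfModules.toSheafify (𝟙 X.ringCatSheaf.obj)
    (CategoryTheory.toSheafify (Opens.grothendieckTopology X) P.presheaf)

instance (P : X.PresheafOfModules) :
    PresheafOfModules.IsLocallyInjective (Opens.grothendieckTopology X) (toShf P) :=
  inferInstanceAs (PresheafOfModules.IsLocallyInjective _ (PresheafOfModules.toSheafify _ _))

instance (P : X.PresheafOfModules) :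
    PresheafOfModules.IsLocallySurjective (Opens.grothendieckTopology X) (toShf P) :=
  inferInstanceAs (PresheafOfModules.IsLocallySurjective _ (PresheafOfModules.toSheafify _ _))

variable {P : X.PresheafOfModules} {Q M N : X.Modules} (f : P ⟶ Q.val)
  [PresheafOfModules.IsLocallyInjective (Opens.grothendieckTopology X) f]
  [PresheafOfModules.IsLocallySurjective (Opens.grothendieckTopology X) f]

/-- If `f` exhibits `Q` as the sheaf associated with the presheaf of modules `P`, this is the
morphism of sheaves `Q ⟶ M` induced by a morphism of presheaves from `P` to the sheaf `M`. -/
def descend (g : P ⟶ M.val) : Q ⟶ M :=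
  ⟨(PresheafOfModules.homEquivOfIsLocallyBijective (J := Opens.grothendieckTopology X)
    f M.isSheaf).symm g⟩

theorem fac_descend (g : P ⟶ M.val) : f ≫ (descend f g).val = g :=
  (PresheafOfModules.homEquivOfIsLocallyBijective (J := Opens.grothendieckTopology X)
    f M.isSheaf).apply_symm_apply g

theorem hom_ext_of_descend {g h : Q ⟶ M} (H : f ≫ g.val = f ≫ h.val) : g = h :=
  SheafOfModules.hom_ext ((PresheafOfModules.homEquivOfIsLocallyBijective
    (J := Opens.grothendieckTopology X) f M.isSheaf).injective H)

theorem val_comp (g : Q ⟶ M) (h : M ⟶ N) : (g ≫ h).val = g.val ≫ h.val := rfl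

theorem val_zero : (0 : Q ⟶ M).val = 0 := rfl

end Descend

instance (i : ℕ) :
    PresheafOfModules.IsLocallyInjective (Opens.grothendieckTopology X) (toΩ k X i) :=
  inferInstanceAs (PresheafOfModules.IsLocallyInjective _ (PresheafOfModules.toSheafify _ _))

instance (i : ℕ) :
    PresheafOfModules.IsLocallySurjective (Opens.grothendieckTopology X) (toΩ k X i) :=
  inferInstanceAs (PresheafOfModules.IsLocallySurjective _ (PresheafOfModules.toSheafify _ _))

instance (i : ℕ) :
    PresheafOfModules.IsLocallyInjective (Opens.grothendieckTopology X) (toFΩ p k X i) :=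
  inferInstanceAs (PresheafOfModules.IsLocallyInjective _ ((Fpre p k X).map (toΩ k X i)))

instance (i : ℕ) :
    PresheafOfModules.IsLocallySurjective (Opens.grothendieckTopology X) (toFΩ p k X i) :=
  inferInstanceAs (PresheafOfModules.IsLocallySurjective _ ((Fpre p k X).map (toΩ k X i)))

/-- The de Rham differential as a morphism of presheaves of modules
`F_* Ωⁱ(Γ(X, U)/k) → F_* Ωⁱ⁺¹(Γ(X, U)/k)`. -/
def dPre (i : ℕ) : FformsPre p k X i ⟶ FformsPre p k X (i + 1) :=
  PresheafOfModules.homMk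
    { app U := AddCommGrpCat.ofHom (dDeg (k := k) (A := Γ(X, U.unop)) i)
      naturality U V f := by
        ext w
        refine Subtype.ext ?_
        exact (map_d (res k X f) (w : Ωdeg k Γ(X, U.unop) i).1).symm }
    fun U a w => by
      refine Subtype.ext ?_
      have h (b : Γ(X, U.unop)) (v : Ωdeg k Γ(X, U.unop) i) :
          d (b ^ p • v.1) = b ^ p • d v.1 := d_pow_smul p b v.1
      exact h a w

theorem dPre_app (i : ℕ) (U : X.Opensᵒᵖ) (w : Ωdeg k Γ(X, U.unop) i) :
    (dPre p k X i).app U w = (dDeg i w : Ωdeg k Γ(X, U.unop) (i + 1)) := rfl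

theorem dPre_dPre (i : ℕ) : dPre p k X i ≫ dPre p k X (i + 1) = 0 := by
  ext U w
  exact Subtype.ext (d_d (w : Ωdeg k Γ(X, U.unop) i).1)

/-- The morphism of sheaves of modules `F_*d : F_*Ωⁱ → F_*Ωⁱ⁺¹`. -/
def Fd (i : ℕ) : FΩ p k X i ⟶ FΩ p k X (i + 1) :=
  descend (toFΩ p k X i) (dPre p k X i ≫ toFΩ p k X (i + 1))

theorem toFΩ_Fd (i : ℕ) :
    toFΩ p k X i ≫ (Fd p k X i).val = dPre p k X i ≫ toFΩ p k X (i + 1) :=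
  fac_descend _ _

theorem Fd_Fd (i : ℕ) : Fd p k X i ≫ Fd p k X (i + 1) = 0 := by
  apply hom_ext_of_descend (toFΩ p k X i)
  rw [val_comp, val_zero, ← Category.assoc, toFΩ_Fd, Category.assoc, toFΩ_Fd, ← Category.assoc,
    dPre_dPre, zero_comp, comp_zero]

/-- The complex of sheaves of modules `F_*Ω^•`. -/
def FΩComplex : CochainComplex X.Modules ℕ :=
  CochainComplex.of (FΩ p k X) (Fd p k X) (Fd_Fd p k X)

theorem FΩComplex_d (i : ℕ) : (FΩComplex p k X).d i (i + 1) = Fd p k X i :=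
  CochainComplex.of_d _ _ _

/-- The submodule of closed forms in `F_*Ωⁱ(Γ(X, U)/k)`. -/
def closedPre (i : ℕ) : (FformsPre p k X i).Submodule where
  obj U := LinearMap.ker ((dPre p k X i).app U).hom
  map {U V} f w hw := by
    have h := PresheafOfModules.naturality_apply (dPre p k X i) f w
    rw [LinearMap.mem_ker] at hw
    refine h.trans ?_
    erw [hw]
    exact map_zero _

/-- A closed form, regarded as a section of the presheaf of closed forms. -/
def toClosedPre (i : ℕ) (U : X.Opensᵒᵖ) (z : ZDeg k Γ(X, U.unop) i) :
    (closedPre p k X i).toPresheafOfModules.obj U := ⟨z.1, z.2⟩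

/-- The sheaf associated with the presheaf of closed forms. -/
def closedShf (i : ℕ) : X.Modules :=
  (PresheafOfModules.sheafification (𝟙 X.ringCatSheaf.obj)).obj
    (closedPre p k X i).toPresheafOfModules

/-- The canonical map from closed forms to the associated sheaf. -/
def toClosedShf (i : ℕ) : (closedPre p k X i).toPresheafOfModules ⟶ (closedShf p k X i).val :=
  toShf _

instance (i : ℕ) :
    PresheafOfModules.IsLocallyInjective (Opens.grothendieckTopology X) (toClosedShf p k X i) :=
  inferInstanceAs (PresheafOfModules.IsLocallyInjective _ (toShf _))

instance (i : ℕ) :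
    PresheafOfModules.IsLocallySurjective (Opens.grothendieckTopology X) (toClosedShf p k X i) :=
  inferInstanceAs (PresheafOfModules.IsLocallySurjective _ (toShf _))

/-- The inclusion of closed forms into `F_*Ωⁱ`. -/
def closedShfι (i : ℕ) : closedShf p k X i ⟶ FΩ p k X i :=
  descend (toClosedShf p k X i) ((closedPre p k X i).ι ≫ toFΩ p k X i)

theorem closedPre_ι_dPre (i : ℕ) : (closedPre p k X i).ι ≫ dPre p k X i = 0 := by
  ext U w
  exact w.2

theorem closedShfι_Fd (i : ℕ) : closedShfι p k X i ≫ Fd p k X i = 0 := by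
  apply hom_ext_of_descend (toClosedShf p k X i)
  rw [val_comp, val_zero, ← Category.assoc, closedShfι, fac_descend, Category.assoc, toFΩ_Fd,
    ← Category.assoc, closedPre_ι_dPre, zero_comp, comp_zero]

/-- The canonical map from closed forms to the cycles of `F_*Ω^•`. -/
def toCyclesSheaf (i : ℕ) : closedShf p k X i ⟶ (FΩComplex p k X).cycles i :=
  (FΩComplex p k X).liftCycles (closedShfι p k X i) (i + 1) (by simp) (by
    rw [FΩComplex_d]; exact closedShfι_Fd p k X i)

theorem toCyclesSheaf_iCycles (i : ℕ) :
    toCyclesSheaf p k X i ≫ (FΩComplex p k X).iCycles i = closedShfι p k X i :=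
  (FΩComplex p k X).liftCycles_i _ _ _ _

/-- The canonical map from closed forms to the cohomology sheaf of `F_*Ω^•`. -/
def closedToHomology (i : ℕ) :
    (closedPre p k X i).toPresheafOfModules ⟶ ((FΩComplex p k X).homology i).val :=
  toClosedShf p k X i ≫ (toCyclesSheaf p k X i ≫ (FΩComplex p k X).homologyπ i).val

/-- The differential, regarded as a map to closed forms. -/
def dToClosedPre (i : ℕ) : FformsPre p k X i ⟶ (closedPre p k X (i + 1)).toPresheafOfModules :=
  PresheafOfModules.homMk
    { app U := AddCommGrpCat.ofHom (AddMonoidHom.mk'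
        (fun w => ⟨(dPre p k X i).app U w, by
          exact Subtype.ext (d_d (w : Ωdeg k Γ(X, U.unop) i).1)⟩)
        (fun v w => Subtype.ext (map_add ((dPre p k X i).app U).hom v w)))
      naturality U V f := by
        ext w
        refine Subtype.ext ?_
        exact (PresheafOfModules.naturality_apply (dPre p k X i) f w) }
    fun U a w => by
      refine Subtype.ext ?_
      exact LinearMap.map_smul ((dPre p k X i).app U).hom a w

theorem dToClosedPre_ι (i : ℕ) :
    dToClosedPre p k X i ≫ (closedPre p k X (i + 1)).ι = dPre p k X i := rfl

theorem dToClosedPre_closedToHomology (i : ℕ) :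
    dToClosedPre p k X i ≫ closedToHomology p k X (i + 1) = 0 := by
  have h : descend (toFΩ p k X i) (dToClosedPre p k X i ≫ toClosedShf p k X (i + 1)) ≫
      closedShfι p k X (i + 1) = Fd p k X i := by
    apply hom_ext_of_descend (toFΩ p k X i)
    rw [val_comp, ← Category.assoc, fac_descend, Category.assoc, closedShfι, fac_descend, toFΩ_Fd,
      ← Category.assoc, dToClosedPre_ι]
  have h2 : descend (toFΩ p k X i) (dToClosedPre p k X i ≫ toClosedShf p k X (i + 1)) ≫
      toCyclesSheaf p k X (i + 1) ≫ (FΩComplex p k X).homologyπ (i + 1) = 0 := by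
    refine comp_liftCycles_homologyπ_eq_zero (FΩComplex p k X) i _ _ _ (𝟙 (FΩ p k X i)) ?_
    refine h.trans ?_
    exact ((Category.id_comp _).trans (FΩComplex_d p k X i)).symm
  have h3 := congrArg (fun g => toFΩ p k X i ≫ g.val) h2
  rw [val_comp, ← Category.assoc, fac_descend, val_zero, comp_zero, Category.assoc] at h3
  exact h3

theorem closedToHomology_of_exact (i : ℕ) (U : X.Opensᵒᵖ) (z : ZDeg k Γ(X, U.unop) i)
    (hz : (z : Ωdeg k Γ(X, U.unop) i) ∈ BDeg k Γ(X, U.unop) i) :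
    (closedToHomology p k X i).app U (toClosedPre p k X i U z) = 0 := by
  cases i with
  | zero =>
    have h : toClosedPre p k X 0 U z = 0 := Subtype.ext (AddSubgroup.mem_bot.mp hz)
    rw [h]
    exact map_zero ((closedToHomology p k X 0).app U).hom
  | succ i =>
    obtain ⟨w, hw⟩ := hz
    have h : toClosedPre p k X (i + 1) U z = (dToClosedPre p k X i).app U w :=
      Subtype.ext hw.symm
    rw [h]
    exact DFunLike.congr_fun (congrArg (fun g : FformsPre p k X i ⟶
      ((FΩComplex p k X).homology (i + 1)).val => (g.app U).hom)
        (dToClosedPre_closedToHomology p k X i)) w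

/-- The map from the algebraic de Rham cohomology group of `Γ(X, U)` to the sections over `U` of
the cohomology sheaf of `F_*Ω^•`. -/
def cohToHomology (i : ℕ) (U : X.Opensᵒᵖ) :
    HDeg k Γ(X, U.unop) i →+ ((FΩComplex p k X).homology i).val.obj U :=
  QuotientAddGroup.lift _
    (AddMonoidHom.mk' (fun z => (closedToHomology p k X i).app U (toClosedPre p k X i U z))
      fun z z' => map_add ((closedToHomology p k X i).app U).hom (toClosedPre p k X i U z)
        (toClosedPre p k X i U z'))
    fun z hz => closedToHomology_of_exact p k X i U z hz

theorem cohToHomology_mk (i : ℕ) (U : X.Opensᵒᵖ) (z : ZDeg k Γ(X, U.unop) i) :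
    cohToHomology p k X i U (QuotientAddGroup.mk z) =
      (closedToHomology p k X i).app U (toClosedPre p k X i U z) := rfl

theorem invCartier_res (i : ℕ) {U V : X.Opensᵒᵖ} (f : U ⟶ V) (w : Ωdeg k Γ(X, U.unop) i) :
    cohToHomology p k X i V (invCartier p i (mapDeg (res k X f) i w)) =
      ((FΩComplex p k X).homology i).val.map f (cohToHomology p k X i U (invCartier p i w)) := by
  obtain ⟨z, hz⟩ := exists_invCartierRel p w
  rw [invCartier_eq p hz, invCartier_eq p (hz.map p (res k X f)), cohToHomology_mk,
    cohToHomology_mk]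
  exact (PresheafOfModules.naturality_apply (closedToHomology p k X i) f _)

theorem invCartier_smul (i : ℕ) (U : X.Opensᵒᵖ) (a : Γ(X, U.unop)) (w : Ωdeg k Γ(X, U.unop) i) :
    cohToHomology p k X i U (invCartier p i (a • w)) =
      (show X.ringCatSheaf.obj.obj U from a) • cohToHomology p k X i U (invCartier p i w) := by
  obtain ⟨z, hz⟩ := exists_invCartierRel p w
  rw [invCartier_eq p hz, invCartier_eq p (hz.smul p a), cohToHomology_mk, cohToHomology_mk]
  exact LinearMap.map_smul ((closedToHomology p k X i).app U).hom _ _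

/-- The inverse Cartier operator on the presheaf of differential forms. -/
def invCartierPre (i : ℕ) : formsPre k X i ⟶ ((FΩComplex p k X).homology i).val :=
  PresheafOfModules.homMk
    { app U := AddCommGrpCat.ofHom ((cohToHomology p k X i U).comp (invCartier p i))
      naturality U V f := by
        ext w
        exact invCartier_res p k X i f w }
    fun U a w => invCartier_smul p k X i U a w

/-- The inverse Cartier operator `C⁻¹ : Ωⁱ → ℋⁱ(F_*Ω^•)`, the morphism of sheaves of modules that
sends `a db₁ ∧ ⋯ ∧ dbᵢ` to the class of `aᵖ (b₁ ⋯ bᵢ)ᵖ⁻¹ db₁ ∧ ⋯ ∧ dbᵢ`. -/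
def invCartierSheaf (i : ℕ) : Ω k X i ⟶ (FΩComplex p k X).homology i :=
  descend (toΩ k X i) (invCartierPre p k X i)

/-- The sheaf of cycles `Z₁Ωⁱ = Ker(F_*d : F_*Ωⁱ → F_*Ωⁱ⁺¹)`. -/
abbrev ZOne (i : ℕ) : X.Modules := (FΩComplex p k X).cycles i

/-- The inclusion `Z₁Ωⁱ → F_*Ωⁱ`. -/
def ZOneι (i : ℕ) : ZOne p k X i ⟶ FΩ p k X i := (FΩComplex p k X).iCycles i

open ZeroObject in
/-- The sheaf of boundaries `B₁Ωⁱ = Im(F_*d : F_*Ωⁱ⁻¹ → F_*Ωⁱ)`; it vanishes for `i = 0`. -/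
def BOne : ℕ → X.Modules
  | 0 => 0
  | i + 1 => image (Fd p k X i)

/-- The morphism `F_*Ωⁱ → B₁Ωⁱ⁺¹` induced by `F_*d`. -/
def dToBOne (i : ℕ) : FΩ p k X i ⟶ BOne p k X (i + 1) := factorThruImage (Fd p k X i)

open Classical in
/-- The Cartier operator `C : Z₁Ωⁱ → Ωⁱ`: the projection from `Z₁Ωⁱ` to `ℋⁱ(F_*Ω^•)` followed by
the inverse of the isomorphism `C⁻¹`. (It is set to be zero if `C⁻¹` fails to be invertible.) -/
def cartier (i : ℕ) : ZOne p k X i ⟶ Ω k X i :=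
  if _h : IsIso (invCartierSheaf p k X i) then
    (FΩComplex p k X).homologyπ i ≫ (asIso (invCartierSheaf p k X i)).inv
  else 0

/-- The `n`-fold push-forward `Fⁿ_*` of sheaves of modules along the Frobenius, normalised so that
`Fⁿ⁺¹_* M = Fⁿ_* (F_* M)`. -/
def Fpow : ℕ → X.Modules ⥤ X.Modules
  | 0 => 𝟭 _
  | n + 1 => Scheme.Modules.pushforward (frobenius p k X) ⋙ Fpow n

/-- The canonical identification `F_* (Fⁿ_* M) = Fⁿ⁺¹_* M`. -/
def FpowSucc : (n : ℕ) →
    (Fpow p k X n ⋙ Scheme.Modules.pushforward (frobenius p k X) ≅ Fpow p k X (n + 1))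
  | 0 => Functor.leftUnitor _ ≪≫ (Functor.rightUnitor _).symm
  | n + 1 => Functor.associator _ _ _ ≪≫
      Functor.isoWhiskerLeft (Scheme.Modules.pushforward (frobenius p k X)) (FpowSucc n)

/-- The sheaf `ZₙΩⁱ` with its inclusion into `Fⁿ_*Ωⁱ`: one puts `Z₀Ωⁱ = Ωⁱ`, and `Zₙ₊₁Ωⁱ` is the
preimage of `ZₙΩⁱ ⊆ Fⁿ_*Ωⁱ` under `Fⁿ_*C : Fⁿ_*Z₁Ωⁱ → Fⁿ_*Ωⁱ`, embedded by
`Zₙ₊₁Ωⁱ ⊆ Fⁿ_*Z₁Ωⁱ ⊆ Fⁿ⁺¹_*Ωⁱ`. -/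
def ZAux (i : ℕ) : (n : ℕ) → Over ((Fpow p k X n).obj (Ω k X i))
  | 0 => Over.mk (𝟙 (Ω k X i))
  | n + 1 => Over.mk (Y := pullback ((Fpow p k X n).map (cartier p k X i)) (ZAux i n).hom)
      (show _ ⟶ (Fpow p k X n).obj (FΩ p k X i) from
        pullback.fst _ _ ≫ (Fpow p k X n).map (ZOneι p k X i))

/-- The sheaf `ZₙΩⁱ`. -/
def Z (i n : ℕ) : X.Modules := (ZAux p k X i n).left

/-- The inclusion `ZₙΩⁱ → Fⁿ_*Ωⁱ`. -/
def Zι (i n : ℕ) : Z p k X i n ⟶ (Fpow p k X n).obj (Ω k X i) := (ZAux p k X i n).hom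

/-- The inclusion `Zₙ₊₁Ωⁱ → Fⁿ_*Z₁Ωⁱ`. -/
def ZtoFpowZOne (i n : ℕ) : Z p k X i (n + 1) ⟶ (Fpow p k X n).obj (ZOne p k X i) :=
  pullback.fst ((Fpow p k X n).map (cartier p k X i)) (Zι p k X i n)

/-- The restriction `Zₙ₊₁Ωⁱ → ZₙΩⁱ` of `Fⁿ_*C`. -/
def cartierRes (i n : ℕ) : Z p k X i (n + 1) ⟶ Z p k X i n :=
  pullback.snd ((Fpow p k X n).map (cartier p k X i)) (Zι p k X i n)

theorem Zι_succ (i n : ℕ) : Zι p k X i (n + 1) =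
    (ZtoFpowZOne p k X i n ≫ (Fpow p k X n).map (ZOneι p k X i) :) := rfl

theorem isPullback_Z (i n : ℕ) : IsPullback (ZtoFpowZOne p k X i n) (cartierRes p k X i n)
    ((Fpow p k X n).map (cartier p k X i)) (Zι p k X i n) :=
  IsPullback.of_hasPullback _ _

/-- The higher Cartier operator `Cⁿ : ZₙΩⁱ → Ωⁱ`, the composition of the restrictions
`ZₙΩⁱ → Zₙ₋₁Ωⁱ → ⋯ → Z₀Ωⁱ = Ωⁱ` of `Fⁿ⁻¹_*C, …, C`. -/
def higherCartier (i : ℕ) : (n : ℕ) → (Z p k X i n ⟶ Ω k X i)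
  | 0 => 𝟙 _
  | n + 1 => cartierRes p k X i n ≫ higherCartier i n

/-- The composition `Zₙ₊₁Ωⁱ → ZₙΩⁱ → ⋯ → Z₁Ωⁱ` of the restrictions of `Fⁿ_*C, …, F_*C`. -/
def ZtoZOne (i : ℕ) : (n : ℕ) → (Z p k X i (n + 1) ⟶ ZOne p k X i)
  | 0 => ZtoFpowZOne p k X i 0
  | n + 1 => cartierRes p k X i (n + 1) ≫ ZtoZOne i n

end Frobenius
end DeRham

end

/-! ### Generation of an algebra by `p`-th powers and coordinates -/

namespace DeRham

/-! The statement splits into the Cartier isomorphism and a formal argument about pullbacks.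

Cartier isomorphism. The question is local, so let `A` be a smooth `k`-algebra with units `x i`
whose logarithmic differentials form a basis of the one-forms. Such coordinates exist near every
point, because a coordinate vanishing there can be replaced by itself plus `1`. The ring of forms
then has an endomorphism φ (`frobLift`) that raises functions to their `p`-th powers and fixes every
`dlog (x i)`. Its values are closed, and the class of φ(w) is C⁻¹(w) (`cls_frobLift`). It is
injective because `A` is reduced. Since `k` is perfect and `A` is generated by `p`-th powers and the
`x i`, every form is a sum of terms x^α φ(w) (`closure_term`). The Lie derivative L along `x i ∂/∂(x
i)` multiplies such a term by the exponent `α i`. By Fermat, 1 - L^(p-1) keeps the terms with `p ∣ α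
i` and kills the others. By Cartan's formula, L^(p-1) sends closed forms to exact ones. Composing
over all `i` gives a projection e onto the image of φ that commutes with `d` and moves closed forms
only by exact ones (`exists_projection_frobLift`). Hence every closed form is cohomologous to a
unique φ(w), which is the bijectivity of C⁻¹ (`invCartierHom_bijective`). On the scheme, this makes
the presheaf version of C⁻¹ locally bijective, so it exhibits the cohomology sheaf as the
sheafification of the presheaf of forms (`invCartierSheaf_isIso`).

Higher operators. Each `Z` is defined by a pullback, and the Cartesian square follows from the
pasting law by induction (`exists_isPullback_higherCartier`). The operator C is an epimorphism by
the first half, and F_* and base change preserve epimorphisms, so F_*Cⁿ is one too. Pulling the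
kernel sequence of `F_*d` back along an epimorphism gives a short exact sequence
(`shortExact_of_isPullback`). -/

open TensorProduct in
/-- A finite unramified extension of rings of characteristic `p` that contains all `p`-th powers is
trivial. -/
theorem surjective_algebraMap_of_formallyUnramified (p : ℕ) [hp : Fact p.Prime] {B A : Type*}
    [CommRing B] [CommRing A] [Algebra B A] [Module.Finite B A] [Algebra.FormallyUnramified B A]
    (hA : (p : A) = 0) (hpow : ∀ a : A, ∃ b : B, algebraMap B A b = a ^ p) :
    Function.Surjective (algebraMap B A) := by
  -- For a finite extension, surjectivity amounts to `1 ⊗ a = a ⊗ 1` for all `a`. Unramifiedness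
  -- supplies `t` that multiplies to `1` and is annihilated by all these differences; it remains to
  -- see that `t ^ p = 1`.
  rw [← Algebra.isEpi_iff_surjective_algebraMap_of_finite, Algebra.isEpi_iff_forall_one_tmul_eq]
  obtain ⟨t, ht, ht1⟩ := (Algebra.FormallyUnramified.iff_exists_tensorProduct
    (R := B) (S := A)).mp inferInstance
  have hAA : (p : A ⊗[B] A) = 0 := by
    rw [← map_natCast (algebraMap A (A ⊗[B] A)), hA, map_zero]
  let φ := frob p (A ⊗[B] A) hAA
  -- Frobenius kills the diagonal ideal, because `a ^ p` comes from `B` and can cross the tensor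
  -- sign.
  have hker : KaehlerDifferential.ideal B A ≤ RingHom.ker φ := by
    rw [← KaehlerDifferential.span_range_eq_ideal, Ideal.span_le]
    rintro _ ⟨a, rfl⟩
    rw [SetLike.mem_coe, RingHom.mem_ker, map_sub]
    obtain ⟨b, hb⟩ := hpow a
    have h1 : φ ((1 : A) ⊗ₜ[B] a) = algebraMap B _ b := by
      change ((1 : A) ⊗ₜ[B] a) ^ p = _
      rw [Algebra.TensorProduct.tmul_pow, one_pow, ← hb, Algebra.TensorProduct.algebraMap_apply,
        Algebra.algebraMap_eq_smul_one, TensorProduct.tmul_smul, TensorProduct.smul_tmul']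
    have h2 : φ (a ⊗ₜ[B] (1 : A)) = algebraMap B _ b := by
      change (a ⊗ₜ[B] (1 : A)) ^ p = _
      rw [Algebra.TensorProduct.tmul_pow, one_pow, ← hb, Algebra.TensorProduct.algebraMap_apply]
    rw [h1, h2, sub_self]
  have ht2 : φ (1 - t) = 0 := hker (by
    rw [KaehlerDifferential.ideal, RingHom.mem_ker]
    exact (map_sub _ _ _).trans (by rw [map_one]; exact sub_eq_zero.mpr ht1.symm))
  have ht3 : t ^ p = 1 := by
    rw [map_sub, map_one, sub_eq_zero] at ht2
    exact ht2.symm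
  intro a
  have h := congrArg (· * t ^ (p - 1)) (ht a)
  simp only [mul_assoc, zero_mul] at h
  rw [← pow_succ', Nat.sub_add_cancel hp.out.one_le, ht3, mul_one] at h
  exact sub_eq_zero.mp h

variable {k A : Type u} [CommRing k] [CommRing A] [Algebra k A]

/-- If the differentials of `x i` span the differentials of `A`, then `A` is generated as an
algebra by the `x i` and the `p`-th powers. -/
theorem adjoin_pow_union_range (p : ℕ) [hp : Fact p.Prime] [CharP k p]
    [Algebra.FiniteType k A] {I : Type*} (x : I → A)
    (hx : ⊤ ≤ Submodule.span A (Set.range fun i => KaehlerDifferential.D k A (x i))) :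
    Algebra.adjoin k (Set.range (fun a : A => a ^ p) ∪ Set.range x) = ⊤ := by
  set B := Algebra.adjoin k (Set.range (fun a : A => a ^ p) ∪ Set.range x) with hB
  have hpow (a : A) : a ^ p ∈ B := Algebra.subset_adjoin (Or.inl ⟨a, rfl⟩)
  have hxB (i : I) : x i ∈ B := Algebra.subset_adjoin (Or.inr ⟨i, rfl⟩)
  have : Algebra.FiniteType B A := Algebra.FiniteType.of_restrictScalars_finiteType k B A
  have : Algebra.IsIntegral B A := ⟨fun a => by
    refine IsIntegral.of_pow hp.out.pos (n := p) ?_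
    exact isIntegral_algebraMap (R := B) (x := ⟨a ^ p, hpow a⟩)⟩
  have : Module.Finite B A := Algebra.IsIntegral.finite
  have : Algebra.FormallyUnramified B A := by
    constructor
    -- The map from `Ω[A⁄k]` to `Ω[A⁄B]` is onto and kills the spanning elements `d (x i)`, as `x i`
    -- lies in `B`; so the target vanishes.
    have hz : KaehlerDifferential.map k B A A = 0 := by
      refine LinearMap.ext fun w => ?_
      have hw := hx (Submodule.mem_top (x := w))
      induction hw using Submodule.span_induction with
      | mem w hw =>
        obtain ⟨i, rfl⟩ := hw
        rw [KaehlerDifferential.map_D]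
        exact (KaehlerDifferential.D B A).map_algebraMap ⟨x i, hxB i⟩
      | zero => simp
      | add v w _ _ hv hw => rw [map_add, hv, hw, map_add]
      | smul a w _ hw => rw [map_smul, hw, map_smul]
    refine subsingleton_of_forall_eq 0 fun w => ?_
    obtain ⟨v, rfl⟩ := KaehlerDifferential.map_surjective k B A w
    rw [hz]; rfl
  have hs := surjective_algebraMap_of_formallyUnramified p (B := B) (A := A) (natCast_eq_zero k A p)
    fun a => ⟨⟨a ^ p, hpow a⟩, rfl⟩
  refine top_unique fun a _ => ?_
  obtain ⟨b, rfl⟩ := hs a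
  exact b.2

end DeRham

/-! ### Logarithmic coordinates and the lifted Frobenius on forms -/

namespace DeRham

open CliffordAlgebra (involute contractLeft)
open ExteriorAlgebra (ι)

/-- The semilinear universal property of the exterior algebra of a free module. -/
theorem exists_ringHom_exteriorAlgebra {A M R I : Type*} [CommRing A] [AddCommGroup M] [Module A M]
    [Ring R] [Fintype I] (b : Module.Basis I A M) (σ : A →+* R) (hσ : ∀ a r, σ a * r = r * σ a)
    (v : I → R) (hv : ∀ r : I → A, (∑ i, σ (r i) * v i) * (∑ i, σ (r i) * v i) = 0) :
    ∃ f : ExteriorAlgebra A M →+* R, (∀ a, f (algebraMap A _ a) = σ a) ∧ ∀ i, f (ι A (b i)) = v i := by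
  -- Viewing `R` as an `A`-algebra through `σ` turns the semilinear problem into the usual linear
  -- one.
  let _ : Algebra A R := σ.toAlgebra' hσ
  let l : M →ₗ[A] R := b.constr A v
  have hl (w : M) : l w = ∑ i, σ (b.repr w i) * v i := by
    rw [Module.Basis.constr_apply_fintype]
    exact Finset.sum_congr rfl fun i _ => Algebra.smul_def _ _
  refine ⟨(ExteriorAlgebra.lift A ⟨l, fun w => by rw [hl]; exact hv _⟩).toRingHom,
    fun a => AlgHom.commutes _ a, fun i => ?_⟩
  exact (ExteriorAlgebra.lift_ι_apply A _ _ _).trans (b.constr_basis A v i)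

/-- Invertible functions `x i` on `A` whose logarithmic differentials form a basis of `Ω[A⁄k]`. -/
structure LogCoordinates (k A : Type u) [CommRing k] [CommRing A] [Algebra k A] (I : Type) where
  /-- The coordinate functions. -/
  x : I → Aˣ
  /-- The basis of logarithmic differentials. -/
  dlog : Module.Basis I A Ω[A⁄k]
  smul_dlog : ∀ i, (x i : A) • dlog i = KaehlerDifferential.D k A (x i)

namespace LogCoordinates

variable {k A : Type u} [CommRing k] [CommRing A] [Algebra k A] {I : Type}
  (c : LogCoordinates k A I)

/-- The logarithmic form `dlog xᵢ`. -/
noncomputable def form (i : I) : Forms k A := ι A (c.dlog i)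

theorem fn_mul_form (i : I) : fn (c.x i : A) * c.form i = dd k (c.x i : A) := by
  rw [dd, ← c.smul_dlog, LinearMap.map_smul, Algebra.smul_def]; rfl

/-- Differentiating `x⁻¹ dx` yields a multiple of `dx ∧ dx = 0`. The computation is done after
multiplication by the unit `x`, where `x d(x⁻¹) = -x⁻¹ dx` applies directly. -/
theorem d_form (i : I) : d (c.form i) = 0 := by
  have h : c.form i = fn ((c.x i)⁻¹ : Aˣ).val * dd k (c.x i : A) := by
    rw [← fn_mul_form, fn_mul_fn_mul, Units.inv_mul, fn, map_one, one_mul]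
  have h2 : dd k ((c.x i)⁻¹ : Aˣ).val * fn (c.x i : A) =
      - (fn ((c.x i)⁻¹ : Aˣ).val * dd k (c.x i : A)) := by
    have h := dd_mul (k := k) (c.x i : A) ((c.x i)⁻¹ : Aˣ).val
    rw [Units.mul_inv, ← map_one (algebraMap k A), dd_algebraMap] at h
    rw [eq_neg_iff_add_eq_zero, h, fn, ← Algebra.commutes]
  have h3 : d (c.form i) * fn (c.x i : A) = 0 := by
    rw [h, d_mul, d_dd, d_fn, mul_zero, zero_add, mul_assoc, dd, dd, ← Algebra.commutes,
      ← mul_assoc]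
    change dd k _ * fn _ * _ = 0
    rw [h2, neg_mul, mul_assoc, ExteriorAlgebra.ι_sq_zero, mul_zero, neg_zero]
  have h4 := congrArg (· * fn ((c.x i)⁻¹ : Aˣ).val) h3
  simpa only [mul_assoc, zero_mul, ← map_mul, Units.mul_inv, map_one, mul_one] using h4

theorem ι_eq_sum [Fintype I] (w : Ω[A⁄k]) :
    ι A w = ∑ i, fn (c.dlog.repr w i) * c.form i := by
  conv_lhs => rw [← c.dlog.sum_repr w]
  rw [map_sum]
  exact Finset.sum_congr rfl fun i _ => by rw [LinearMap.map_smul, Algebra.smul_def]; rfl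

/-- The forms are generated by functions and logarithmic forms. -/
theorem induction [Fintype I] {P : Forms k A → Prop} (hfn : ∀ a : A, P (fn a))
    (hform : ∀ i, P (c.form i)) (hadd : ∀ x y, P x → P y → P (x + y))
    (hmul : ∀ x y, P x → P y → P (x * y)) (w : Forms k A) : P w := by
  classical
  induction w using Forms.induction with
  | hfn a => exact hfn a
  | hd a =>
    rw [dd, c.ι_eq_sum]
    refine Finset.sum_induction _ P hadd ?_ fun i _ => hmul _ _ (hfn _) (hform i)
    simpa using hfn 0
  | hadd x y hx hy => exact hadd x y hx hy
  | hmul x y hx hy => exact hmul x y hx hy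

section Lift

variable (p : ℕ) [hp : Fact p.Prime] [CharP k p]

/-- Values on the basis of logarithmic forms may be prescribed freely as long as one-forms go to
elements of square zero; here they go to one-forms again. -/
theorem exists_frobLift [Fintype I] : ∃ f : Forms k A →+* Forms k A,
    (∀ a, f (fn a) = fn (a ^ p)) ∧ ∀ i, f (c.form i) = c.form i := by
  obtain ⟨f, hf, hf'⟩ := exists_ringHom_exteriorAlgebra c.dlog
    ((algebraMap A (Forms k A)).comp (frob p A (natCast_eq_zero k A p)))
    (fun a w => Algebra.commutes (R := A) (a ^ p) w) c.form fun r => by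
      have h : ∑ i, ((algebraMap A (Forms k A)).comp (frob p A (natCast_eq_zero k A p))) (r i) *
          c.form i = ι A (∑ i, (r i ^ p) • c.dlog i) := by
        rw [map_sum]
        exact Finset.sum_congr rfl fun i _ => by rw [LinearMap.map_smul, Algebra.smul_def]; rfl
      rw [h, ExteriorAlgebra.ι_sq_zero]
  exact ⟨f, hf, hf'⟩

/-- The Frobenius-semilinear endomorphism of the ring of forms with `a ↦ aᵖ` that fixes the
logarithmic forms. -/
noncomputable def frobLift [Fintype I] : Forms k A →+* Forms k A := (c.exists_frobLift p).choose

/-- The inverse Cartier operator sends `x⁻¹ dx` to the class of `x⁻ᵖ xᵖ⁻¹ dx = x⁻¹ dx`. -/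
theorem cls_logForm (i : I) : cls p ⟨c.form i, mem_Closed.mpr (c.d_form i)⟩ = invCartierHom p (c.form i) := by
  have h : fn (c.x i : A) * c.form i = dd k (c.x i : A) := c.fn_mul_form i
  have hx : c.form i = fn ((c.x i)⁻¹ : Aˣ).val * dd k (c.x i : A) := by
    rw [← fn_mul_form, fn_mul_fn_mul, Units.inv_mul, fn, map_one, one_mul]
  conv_rhs => rw [hx]
  rw [map_mul, invCartierHom_fn, invCartierHom_dd, ← map_mul]
  congr 1
  refine Subtype.ext ?_
  rw [Subring.coe_mul, coe_frobClosed, logForm, fn_mul_fn_mul]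
  change c.form i = _
  rw [hx]
  congr 2
  have hp' : p = p - 1 + 1 := (Nat.sub_add_cancel hp.out.one_le).symm
  conv_rhs => rw [hp', pow_succ, mul_right_comm, Nat.add_sub_cancel, ← mul_pow, Units.inv_mul,
    one_pow, one_mul]

variable [Fintype I]

theorem frobLift_fn (a : A) : c.frobLift p (fn a) = fn (a ^ p) :=
  (c.exists_frobLift p).choose_spec.1 a

theorem frobLift_form (i : I) : c.frobLift p (c.form i) = c.form i :=
  (c.exists_frobLift p).choose_spec.2 i

theorem d_frobLift (w : Forms k A) : d (c.frobLift p w) = 0 := by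
  induction w using c.induction with
  | hfn a => rw [frobLift_fn, d_fn, dd_pow, natCast_eq_zero k A p]; simp
  | hform i => rw [frobLift_form, d_form]
  | hadd x y hx hy => rw [map_add, map_add, hx, hy, add_zero]
  | hmul x y hx hy => rw [map_mul, d_mul, hx, hy, mul_zero, zero_mul, add_zero]

/-- The class of the lift of a form is its image under the inverse Cartier operator. -/
theorem cls_frobLift (w : Forms k A) :
    cls p ⟨c.frobLift p w, mem_Closed.mpr (c.d_frobLift p w)⟩ = invCartierHom p w := by
  induction w using c.induction with
  | hfn a =>
    rw [invCartierHom_fn]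
    congr 1
    exact Subtype.ext (c.frobLift_fn p a)
  | hform i =>
    rw [← c.cls_logForm]
    congr 1
    exact Subtype.ext (c.frobLift_form p i)
  | hadd x y hx hy =>
    rw [map_add (invCartierHom p), ← hx, ← hy, ← map_add]
    congr 1
    exact Subtype.ext (map_add _ x y)
  | hmul x y hx hy =>
    rw [map_mul (invCartierHom p), ← hx, ← hy, ← map_mul]
    congr 1
    exact Subtype.ext (map_mul _ x y)

/-- In the basis of wedge products of logarithmic forms the lift raises every coefficient to its
`p`-th power, which loses nothing over a reduced ring. -/
theorem frobLift_injective [IsReduced A] : Function.Injective (c.frobLift p) := by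
  -- Any order will do: it only fixes the order of the factors in the basis products, which are
  -- indexed by finite subsets of `I`.
  let _ : LinearOrder I := LinearOrder.lift' _ (Fintype.equivFin I).injective
  rw [injective_iff_map_eq_zero]
  intro w hw
  let b := c.dlog.ExteriorAlgebra
  have hb (s : Finset I) : c.frobLift p (b s) = b s := by
    rw [ExteriorAlgebra.basis_apply]
    change c.frobLift p (ExteriorAlgebra.ιMulti A _ _) = ExteriorAlgebra.ιMulti A _ _
    rw [ExteriorAlgebra.ιMulti_apply, map_list_prod, List.map_ofFn]
    congr 2
    funext j
    exact c.frobLift_form p _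
  have h : ∑ s, (b.repr w s) ^ p • b s = 0 := by
    rw [← hw]
    conv_rhs => rw [← b.sum_repr w, map_sum]
    refine Finset.sum_congr rfl fun s _ => ?_
    rw [Algebra.smul_def, Algebra.smul_def, map_mul, hb]
    exact congrArg (· * b s) (c.frobLift_fn p _).symm
  rw [← b.sum_repr w]
  refine Finset.sum_eq_zero fun s _ => ?_
  have h2 := Fintype.linearIndependent_iff.mp b.linearIndependent _ h s
  rw [eq_zero_of_pow_eq_zero h2, zero_smul]

end Lift

end LogCoordinates
end DeRham

/-! ### Lie derivatives and their eigenforms -/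

namespace DeRham

open CliffordAlgebra (involute contractLeft)
open ExteriorAlgebra (ι)

theorem contractLeft_mul {A M : Type*} [CommRing A] [AddCommGroup M] [Module A M]
    (f : Module.Dual A M) (v w : ExteriorAlgebra A M) :
    contractLeft f (v * w) = contractLeft f v * w + involute v * contractLeft f w := by
  induction v using ExteriorAlgebra.induction generalizing w with
  | algebraMap a =>
    rw [CliffordAlgebra.contractLeft_algebraMap_mul, AlgHom.commutes,
      CliffordAlgebra.contractLeft_algebraMap, zero_mul, zero_add]
  | ι v =>
    rw [CliffordAlgebra.contractLeft_ι_mul, CliffordAlgebra.involute_ι,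
      CliffordAlgebra.contractLeft_ι, Algebra.smul_def, neg_mul, sub_eq_add_neg]
  | mul x y hx hy =>
    rw [mul_assoc, hx, hy, hx, map_mul]
    noncomm_ring
  | add x y hx hy => rw [add_mul, map_add, hx, hy, map_add, map_add, add_mul, add_mul]; abel

theorem contractLeft_involute {A M : Type*} [CommRing A] [AddCommGroup M] [Module A M]
    (f : Module.Dual A M) (v : ExteriorAlgebra A M) :
    contractLeft f (involute v) = - involute (contractLeft f v) := by
  induction v using ExteriorAlgebra.induction with
  | algebraMap a =>
    rw [AlgHom.commutes, CliffordAlgebra.contractLeft_algebraMap, map_zero, neg_zero]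
  | ι v =>
    rw [CliffordAlgebra.involute_ι, map_neg, CliffordAlgebra.contractLeft_ι, AlgHom.commutes]
  | mul x y hx hy =>
    rw [map_mul, contractLeft_mul, hx, hy, contractLeft_mul, map_add, map_mul, map_mul]
    simp only [CliffordAlgebra.involute_involute]
    noncomm_ring
  | add x y hx hy => rw [map_add, map_add, hx, hy, map_add, map_add, neg_add]

section Lie

variable {k A : Type u} [CommRing k] [CommRing A] [Algebra k A]

theorem fn_add (a b : A) : fn (k := k) (a + b) = fn a + fn b := map_add _ a b

theorem fn_mul (a b : A) : fn (k := k) (a * b) = fn a * fn b := map_mul _ a b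

theorem fn_pow (a : A) (n : ℕ) : fn (k := k) (a ^ n) = fn a ^ n := map_pow _ a n

/-- The Lie derivative `[d, f⌋]` of forms along the derivation corresponding to a linear form on
`Ω[A⁄k]`. -/
noncomputable def lie (f : Module.Dual A Ω[A⁄k]) : AddMonoid.End (Forms k A) :=
  AddMonoidHom.mk' (fun w => d (contractLeft f w) + contractLeft f (d w)) fun v w => by
    simp only [map_add]; abel

theorem lie_apply (f : Module.Dual A Ω[A⁄k]) (w : Forms k A) :
    lie f w = d (contractLeft f w) + contractLeft f (d w) := rfl

/-- By `d² = 0` both sides equal `d` of the contraction of `dw`. This is what makes the projections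
built from `lie` commute with `d`. -/
theorem lie_d (f : Module.Dual A Ω[A⁄k]) (w : Forms k A) : lie f (d w) = d (lie f w) := by
  rw [lie_apply, lie_apply, d_d, map_add, d_d, map_zero, zero_add, add_zero]

/-- Contraction and `d` are both antiderivations, so their anticommutator is a derivation: the terms
involving `involute` cancel. -/
theorem lie_mul (f : Module.Dual A Ω[A⁄k]) (v w : Forms k A) :
    lie f (v * w) = lie f v * w + v * lie f w := by
  simp only [lie_apply, contractLeft_mul, d_mul, map_add, contractLeft_involute, d_involute,
    CliffordAlgebra.involute_involute]
  noncomm_ring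

theorem lie_fn (f : Module.Dual A Ω[A⁄k]) (a : A) :
    lie f (fn a) = fn (f (KaehlerDifferential.D k A a)) := by
  rw [lie_apply, CliffordAlgebra.contractLeft_algebraMap, map_zero, zero_add, d_fn,
    CliffordAlgebra.contractLeft_ι]

end Lie

namespace LogCoordinates

variable {k A : Type u} [CommRing k] [CommRing A] [Algebra k A] {I : Type}
  (c : LogCoordinates k A I)

/-- Both terms of Cartan's formula vanish: the form is closed, and its contraction is the constant
`0` or `1`. -/
theorem lie_form (i j : I) : lie (c.dlog.coord i) (c.form j) = 0 := by
  classical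
  rw [lie_apply, d_form, map_zero, add_zero, form, CliffordAlgebra.contractLeft_ι,
    Module.Basis.coord_apply, Module.Basis.repr_self, Finsupp.single_apply]
  split_ifs
  · rw [map_one, ← map_one (algebraMap A (Forms k A)), d_fn, ← map_one (algebraMap k A), dd_algebraMap]
  · rw [map_zero, map_zero]

/-- The linear form dual to `dlog (x i)` corresponds to the derivation `x i ∂/∂(x i)`. -/
theorem lie_x [DecidableEq I] (i j : I) :
    lie (c.dlog.coord i) (fn (c.x j : A)) = (Pi.single j 1 : I → ℕ) i • fn (c.x j : A) := by
  rw [lie_fn, ← c.smul_dlog, map_smul, Module.Basis.coord_apply, Module.Basis.repr_self,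
    Finsupp.single_apply, Pi.single_apply]
  by_cases h : j = i
  · simp [h]
  · simp [h, Ne.symm h]

variable [Fintype I]

theorem lie_monomial (i : I) (α : I → ℕ) :
    lie (c.dlog.coord i) (fn (∏ j, (c.x j : A) ^ α j)) =
      α i • fn (∏ j, (c.x j : A) ^ α j) := by
  classical
  have hpow (j : I) (n : ℕ) : lie (c.dlog.coord i) (fn (c.x j : A) ^ n) =
      (Pi.single j n : I → ℕ) i • fn (c.x j : A) ^ n := by
    induction n with
    | zero =>
      rw [pow_zero, Pi.single_zero, Pi.zero_apply, zero_smul, ← map_one (algebraMap A (Forms k A)),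
        lie_fn, ← map_one (algebraMap k A), Derivation.map_algebraMap, map_zero, fn, map_zero]
    | succ n ih =>
      rw [pow_succ, lie_mul, ih, lie_x, smul_mul_assoc, mul_smul_comm, ← add_smul, Pi.single_add]
      rfl
  suffices h : ∀ s : Finset I, lie (c.dlog.coord i) (fn (∏ j ∈ s, (c.x j : A) ^ α j)) =
      (∑ j ∈ s, (Pi.single j (α j) : I → ℕ) i) • fn (∏ j ∈ s, (c.x j : A) ^ α j) by
    rw [h]
    congr 1
    simp [Pi.single_apply]
  intro s
  induction s using Finset.induction_on with
  | empty => simpa using hpow i 0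
  | insert j s hj ih =>
    rw [Finset.prod_insert hj, fn_mul, lie_mul, ih, Finset.sum_insert hj, fn_pow, hpow,
      smul_mul_assoc, mul_smul_comm, ← add_smul]

variable (p : ℕ) [hp : Fact p.Prime] [CharP k p]

/-- Lifted forms are built from `p`-th powers, whose differentials vanish, and logarithmic forms; a
derivation killing both kills them all. -/
theorem lie_frobLift (i : I) (w : Forms k A) :
    lie (c.dlog.coord i) (c.frobLift p w) = 0 := by
  induction w using c.induction with
  | hfn a =>
    rw [frobLift_fn, lie_apply, CliffordAlgebra.contractLeft_algebraMap, d_fn, dd_pow,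
      natCast_eq_zero k A p]
    simp
  | hform j => rw [frobLift_form, lie_form]
  | hadd x y hx hy => rw [map_add, map_add, hx, hy, add_zero]
  | hmul x y hx hy => rw [map_mul, lie_mul, hx, hy, mul_zero, zero_mul, add_zero]

/-- The product of a monomial in the coordinates and a lifted form. -/
noncomputable def term (α : I → ℕ) (w : Forms k A) : Forms k A :=
  fn (∏ j, (c.x j : A) ^ α j) * c.frobLift p w

theorem lie_term (i : I) (α : I → ℕ) (w : Forms k A) :
    lie (c.dlog.coord i) (c.term p α w) = α i • c.term p α w := by
  rw [term, lie_mul, lie_frobLift, mul_zero, add_zero, lie_monomial, smul_mul_assoc]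

theorem lie_pow_term (i : I) (α : I → ℕ) (w : Forms k A) (n : ℕ) :
    (lie (c.dlog.coord i) ^ n) (c.term p α w) = α i ^ n • c.term p α w := by
  induction n with
  | zero => rw [pow_zero, pow_zero, one_smul]; rfl
  | succ n ih =>
    rw [pow_succ', AddMonoid.End.coe_mul, Function.comp_apply, ih, map_nsmul, lie_term, smul_smul, pow_succ]

/-- Every form is a sum of products of monomials in the coordinates and lifted forms. -/
theorem closure_term {k : Type u} [Field k] [PerfectField k] [CharP k p] [Algebra k A]
    (c : LogCoordinates k A I) [Algebra.FiniteType k A] :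
    AddSubgroup.closure {z | ∃ α w, z = c.term p α w} = ⊤ := by
  classical
  -- Functions are central, so these products are closed under multiplication and their additive
  -- closure is a subring. It is then enough to find the functions and the logarithmic forms in it.
  let M : Submonoid (Forms k A) :=
    { carrier := {z | ∃ α w, z = c.term p α w}
      one_mem' := ⟨0, 1, by simp [term]⟩
      mul_mem' := by
        rintro _ _ ⟨α, v, rfl⟩ ⟨β, w, rfl⟩
        refine ⟨α + β, v * w, ?_⟩
        rw [term, term, term, map_mul]
        simp only [Pi.add_apply, pow_add, Finset.prod_mul_distrib]
        rw [fn_mul, mul_assoc, mul_assoc, ← mul_assoc (c.frobLift p v),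
          ← Algebra.commutes _ (c.frobLift p v), mul_assoc] }
  have hlift (w : Forms k A) : c.frobLift p w ∈ Subring.closure (M : Set (Forms k A)) :=
    Subring.subset_closure ⟨0, w, by simp [term]⟩
  have hfn (a : A) : fn a ∈ Subring.closure (M : Set (Forms k A)) := by
    have ha : a ∈ Algebra.adjoin k (Set.range (fun a : A => a ^ p) ∪
        Set.range fun i => (c.x i : A)) := by
      rw [adjoin_pow_union_range p]
      · trivial
      rw [← c.dlog.span_eq, Submodule.span_le]
      rintro _ ⟨i, rfl⟩
      have h : c.dlog i = ((c.x i)⁻¹ : Aˣ).val • KaehlerDifferential.D k A (c.x i : A) := by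
        rw [← c.smul_dlog, smul_smul, Units.inv_mul, one_smul]
      rw [h]
      exact Submodule.smul_mem _ _ (Submodule.subset_span ⟨i, rfl⟩)
    induction ha using Algebra.adjoin_induction with
    | mem a ha =>
      obtain ⟨b, rfl⟩ | ⟨i, rfl⟩ := ha
      · exact c.frobLift_fn p b ▸ hlift (fn b)
      · refine Subring.subset_closure ⟨Pi.single i 1, 1, ?_⟩
        rw [term, map_one, mul_one]
        congr 1
        rw [Finset.prod_eq_single i]
        · simp
        · intro j _ hj; simp [hj]
        · simp
    | algebraMap b =>
      -- Perfectness enters here: constants are `p`-th powers, hence lifts.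
      have : ExpChar k p := ExpChar.prime hp.out
      obtain ⟨b', rfl⟩ := (PerfectRing.bijective_frobenius (R := k) (p := p)).2 b
      change fn (algebraMap k A (b' ^ p)) ∈ _
      rw [map_pow]
      exact c.frobLift_fn p _ ▸ hlift (fn _)
    | add x y _ _ hx hy => rw [fn_add]; exact add_mem hx hy
    | mul x y _ _ hx hy => rw [fn_mul]; exact mul_mem hx hy
  refine top_unique fun z _ => ?_
  have hz : z ∈ Subring.closure (M : Set (Forms k A)) := by
    induction z using c.induction with
    | hfn a => exact hfn a
    | hform i => exact c.frobLift_form p i ▸ hlift _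
    | hadd x y hx hy => exact add_mem (hx trivial) (hy trivial)
    | hmul x y hx hy => exact mul_mem (hx trivial) (hy trivial)
  rw [Subring.mem_closure_iff, Submonoid.closure_eq] at hz
  exact hz

end LogCoordinates
end DeRham

/-! ### Projection onto lifted forms and the Cartier isomorphism of an algebra -/

namespace DeRham

open CliffordAlgebra (involute contractLeft)
open ExteriorAlgebra (ι)

theorem lie_pow_d {k A : Type u} [CommRing k] [CommRing A] [Algebra k A]
    (f : Module.Dual A Ω[A⁄k]) (n : ℕ) (w : Forms k A) : (lie f ^ n) (d w) = d ((lie f ^ n) w) := by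
  induction n with
  | zero => rfl
  | succ n ih =>
    rw [pow_succ', AddMonoid.End.coe_mul, Function.comp_apply, ih, lie_d]; rfl

namespace LogCoordinates

variable {A : Type u} [CommRing A] {I : Type} [Fintype I] (p : ℕ) [hp : Fact p.Prime]

section Projection

variable {k : Type u} [CommRing k] [Algebra k A] [CharP k p] (c : LogCoordinates k A I)

/-- Fermat's little theorem in `ZMod p`, carried to `A` through `k`. Combined with `lie_pow_term` it
says that the `(p - 1)`-st power of a Lie derivative retains exactly the terms whose exponent is
prime to `p`. -/
theorem pow_sub_one_smul_term (n : ℕ) (α : I → ℕ) (w : Forms k A) :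
    (n ^ (p - 1)) • c.term p α w = if p ∣ n then 0 else c.term p α w := by
  have h : (n ^ (p - 1) : ℕ) • c.term p α w = fn ((n : A) ^ (p - 1)) * c.term p α w := by
    rw [nsmul_eq_mul, ← Nat.cast_pow, fn, map_natCast]
  have hp1 : p - 1 ≠ 0 := Nat.sub_ne_zero_of_lt hp.out.one_lt
  rw [h]
  split_ifs with hn
  · obtain ⟨m, rfl⟩ := hn
    rw [Nat.cast_mul, natCast_eq_zero k A p, zero_mul, zero_pow hp1, fn, map_zero, zero_mul]
  · have h1 : ((n : ZMod p)) ^ (p - 1) = 1 :=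
      ZMod.pow_card_sub_one_eq_one (by rwa [Ne, ZMod.natCast_eq_zero_iff])
    have h2 : (n : A) ^ (p - 1) = 1 := by
      have h3 := congrArg (fun z : ZMod p => algebraMap k A (ZMod.castHom dvd_rfl k z)) h1
      simpa using h3
    rw [h2, fn, map_one, one_mul]

/-- A projection, homotopic to the identity, that kills all terms whose exponents at a given set of
coordinates are not all divisible by `p`, and keeps the others. -/
theorem exists_projection (s : Finset I) : ∃ e : AddMonoid.End (Forms k A),
    (∀ w, e (d w) = d (e w)) ∧ (∀ z, d z = 0 → ∃ u, d u = z - e z) ∧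
    ∀ α w, e (c.term p α w) = if ∀ i ∈ s, p ∣ α i then c.term p α w else 0 := by
  classical
  induction s using Finset.induction_on with
  | empty => exact ⟨1, fun _ => rfl, fun z _ => ⟨0, by simp⟩, fun α w => by simp⟩
  | insert i s hi ih =>
    obtain ⟨e, he, he1, he2⟩ := ih
    let l := lie (c.dlog.coord i)
    -- On closed forms Cartan's formula reduces to `l = d ∘ contraction`, so `l ^ (p - 1)` applied
    -- to `z` is `d` of the contraction of `l ^ (p - 2)` applied to `z`.
    have hl (z : Forms k A) (hz : d z = 0) : ∃ u, d u = (l ^ (p - 1)) z := by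
      obtain ⟨m, hm⟩ : ∃ m, p - 1 = m + 1 :=
        ⟨p - 2, by have := hp.out.two_le; omega⟩
      refine ⟨contractLeft (c.dlog.coord i) ((l ^ m) z), ?_⟩
      rw [hm, pow_succ', AddMonoid.End.coe_mul, Function.comp_apply]
      change _ = lie _ _
      rw [lie_apply, ← lie_pow_d, hz, map_zero, map_zero, add_zero]
    have hsub (z : Forms k A) : (e - e * l ^ (p - 1) : AddMonoid.End (Forms k A)) z =
        e z - e ((l ^ (p - 1)) z) := rfl
    -- This is `e ∘ (1 - l ^ (p - 1))`; the second factor discards the terms with `p ∤ α i`.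
    refine ⟨e - e * l ^ (p - 1), fun w => ?_, fun z hz => ?_, fun α w => ?_⟩
    · rw [hsub, hsub, map_sub, lie_pow_d, he, he]
    · obtain ⟨u, hu⟩ := he1 z hz
      obtain ⟨v, hv⟩ := hl z hz
      refine ⟨u + e v, ?_⟩
      rw [map_add, hu, ← he, hv, hsub]
      abel
    · rw [hsub, lie_pow_term, pow_sub_one_smul_term]
      by_cases h : p ∣ α i
      · simp only [h, if_true, map_zero, sub_zero, he2, Finset.forall_mem_insert, true_and]
        congr
      · simp only [h, if_false, sub_self, Finset.forall_mem_insert, false_and]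

theorem term_mem_range (α : I → ℕ) (hα : ∀ i, p ∣ α i) (w : Forms k A) :
    c.term p α w ∈ (c.frobLift p).range := by
  choose β hβ using hα
  refine ⟨fn (∏ j, (c.x j : A) ^ β j) * w, ?_⟩
  rw [map_mul, frobLift_fn, ← Finset.prod_pow, term]
  congr 2
  exact Finset.prod_congr rfl fun j _ => by rw [hβ j, mul_comm p, pow_mul]

end Projection

variable {k : Type u} [Field k] [PerfectField k] [CharP k p] [Algebra k A]
  [Algebra.FiniteType k A]

/-- With all coordinates taken into account, the surviving exponents are all divisible by `p`, so
the monomial is itself a `p`-th power and the term is a lift. The terms generate all forms, so this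
controls the whole image of `e`. -/
theorem exists_projection_frobLift (c : LogCoordinates k A I) : ∃ e : AddMonoid.End (Forms k A),
    (∀ w, e (d w) = d (e w)) ∧ (∀ z, d z = 0 → ∃ u, d u = z - e z) ∧
    (∀ w, e (c.frobLift p w) = c.frobLift p w) ∧ ∀ z, e z ∈ (c.frobLift p).range := by
  obtain ⟨e, he, he1, he2⟩ := c.exists_projection p Finset.univ
  refine ⟨e, he, he1, fun w => ?_, fun z => ?_⟩
  · have h := he2 0 w
    simpa [term] using h
  · have hz : z ∈ AddSubgroup.closure {z | ∃ α w, z = c.term p α w} := by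
      rw [c.closure_term p]; trivial
    induction hz using AddSubgroup.closure_induction with
    | mem z hz =>
      obtain ⟨α, w, rfl⟩ := hz
      rw [he2]
      split_ifs with h
      · exact c.term_mem_range p α (fun i => h i (Finset.mem_univ i)) w
      · exact zero_mem _
    | zero => rw [map_zero]; exact zero_mem _
    | add x y _ _ hx hy => rw [map_add]; exact add_mem hx hy
    | neg x _ hx => rw [map_neg]; exact neg_mem hx

/-- The inverse Cartier operator is bijective. -/
theorem invCartierHom_bijective [IsReduced A] (c : LogCoordinates k A I) :
    Function.Bijective (invCartierHom p : Forms k A → Coh k A p) := by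
  obtain ⟨e, he, he1, he2, he3⟩ := c.exists_projection_frobLift p
  constructor
  · rw [injective_iff_map_eq_zero]
    intro w hw
    rw [← c.cls_frobLift p, ← map_zero (cls p), cls_eq_iff] at hw
    obtain ⟨u, hu⟩ := hw
    have hu' : d u = c.frobLift p w := hu.trans (sub_zero _)
    obtain ⟨v, hv⟩ := he3 u
    -- A lift of the form `du` is fixed by `e`, hence equals `d (e u)`; but `e u` is a lift too, so
    -- it is closed and the original lift is zero.
    refine c.frobLift_injective p ?_
    rw [map_zero, ← he2, ← hu', he, ← hv, d_frobLift]
  · intro y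
    obtain ⟨z, rfl⟩ := cls_surjective p y
    -- A closed `z` is cohomologous to `e z`, which is the lift of some `w`; this `w` is the
    -- preimage.
    obtain ⟨u, hu⟩ := he1 z z.2
    obtain ⟨w, hw⟩ := he3 z
    refine ⟨w, ?_⟩
    rw [← c.cls_frobLift p, eq_comm, cls_eq_iff]
    exact ⟨u, by rw [hu, ← hw]⟩

end LogCoordinates

/-! ### From the total inverse Cartier operator to its homogeneous parts -/

section Degree

variable {k A : Type u} [CommRing k] [CommRing A] [Algebra k A]

/-- The component of degree `i` of a form. -/
noncomputable def component (i : ℕ) : Forms k A →+ Forms k A :=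
  GradedRing.proj (fun i : ℕ => ⋀[A]^i Ω[A⁄k]) i

theorem component_mem (i : ℕ) (w : Forms k A) : component i w ∈ ⋀[A]^i Ω[A⁄k] :=
  SetLike.coe_mem (DirectSum.decompose (fun i : ℕ => ⋀[A]^i Ω[A⁄k]) w i)

theorem component_of_mem {i : ℕ} {w : Forms k A} (hw : w ∈ ⋀[A]^i Ω[A⁄k]) : component i w = w :=
  DirectSum.decompose_of_mem_same (fun i : ℕ => ⋀[A]^i Ω[A⁄k]) hw

theorem component_of_mem_of_ne {i j : ℕ} {w : Forms k A} (hw : w ∈ ⋀[A]^i Ω[A⁄k]) (h : i ≠ j) :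
    component j w = 0 :=
  DirectSum.decompose_of_mem_ne (fun i : ℕ => ⋀[A]^i Ω[A⁄k]) hw h

@[elab_as_elim]
theorem Forms.homogeneous_induction {P : Forms k A → Prop} (h0 : P 0)
    (hmem : ∀ (i : ℕ) (w : Forms k A), w ∈ ⋀[A]^i Ω[A⁄k] → P w)
    (hadd : ∀ v w, P v → P w → P (v + w)) (w : Forms k A) : P w :=
  DirectSum.Decomposition.inductionOn (fun i : ℕ => ⋀[A]^i Ω[A⁄k]) h0
    (fun {i} w => hmem i w w.2) hadd w

theorem exists_d_eq_component (u : Forms k A) (i : ℕ) : ∃ v : Forms k A, d v = component i (d u) := by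
  induction u using Forms.homogeneous_induction with
  | h0 => exact ⟨0, by simp⟩
  | hmem j u hu =>
    by_cases h : j + 1 = i
    · subst h
      exact ⟨u, (component_of_mem (d_mem hu)).symm⟩
    · exact ⟨0, by rw [component_of_mem_of_ne (d_mem hu) h, map_zero]⟩
  | hadd v w hv hw =>
    obtain ⟨v', hv⟩ := hv
    obtain ⟨w', hw⟩ := hw
    exact ⟨v' + w', by rw [map_add, map_add, map_add, hv, hw]⟩

variable (p : ℕ) [hp : Fact p.Prime] [CharP k p]

/-- `Coh` carries no grading here, so compatibility with degrees is expressed by one representative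
`y` whose components represent the values at the components of `w`. -/
theorem exists_invCartierHom_component (w : Forms k A) : ∃ y : Closed k A,
    invCartierHom p w = cls p y ∧ ∀ i, ∃ h : component i (y : Forms k A) ∈ Closed k A,
      invCartierHom p (component i w) = cls p ⟨_, h⟩ := by
  induction w using Forms.homogeneous_induction with
  | h0 =>
    refine ⟨0, by rw [map_zero, map_zero], fun i => ?_⟩
    have h : component i ((0 : Closed k A) : Forms k A) = 0 := map_zero _
    refine ⟨h ▸ zero_mem _, ?_⟩
    rw [map_zero, map_zero, eq_comm, ← map_zero (cls p)]
    exact congrArg (cls p) (Subtype.ext h)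
  | hmem j w hw =>
    obtain ⟨y, hy, h⟩ := exists_invCartierHom_eq p hw
    refine ⟨y, h, fun i => ?_⟩
    by_cases hij : j = i
    · subst hij
      refine ⟨by rw [component_of_mem hy]; exact y.2, ?_⟩
      rw [component_of_mem hw, h]
      exact congrArg (cls p) (Subtype.ext (component_of_mem hy).symm)
    · have h0 := component_of_mem_of_ne hy hij
      refine ⟨h0 ▸ zero_mem _, ?_⟩
      rw [component_of_mem_of_ne hw hij, map_zero, eq_comm, ← map_zero (cls p)]
      exact congrArg (cls p) (Subtype.ext h0)
  | hadd v w hv hw =>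
    obtain ⟨v', hv, hv'⟩ := hv
    obtain ⟨w', hw, hw'⟩ := hw
    refine ⟨v' + w', by rw [map_add, map_add, hv, hw], fun i => ?_⟩
    obtain ⟨h1, h1'⟩ := hv' i
    obtain ⟨h2, h2'⟩ := hw' i
    have h : component i ((v' + w' : Closed k A) : Forms k A) =
      component i (v' : Forms k A) + component i (w' : Forms k A) := map_add _ _ _
    refine ⟨h ▸ add_mem h1 h2, ?_⟩
    rw [map_add, map_add, h1', h2', ← map_add]
    exact congrArg (cls p) (Subtype.ext h.symm)

theorem invCartier_bijective
    (h : Function.Bijective (invCartierHom p : Forms k A → Coh k A p)) (i : ℕ) :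
    Function.Bijective (invCartier p i : Ωdeg k A i → HDeg k A i) := by
  constructor
  · rw [injective_iff_map_eq_zero]
    intro w hw
    obtain ⟨z, hz⟩ := exists_invCartierRel p w
    rw [invCartier_eq p hz, QuotientAddGroup.eq_zero_iff, AddSubgroup.mem_addSubgroupOf] at hw
    refine Subtype.ext (h.1 ?_)
    rw [(invCartierRel_iff p w z).mp hz]
    refine Eq.trans ?_ (map_zero _).symm
    rw [← map_zero (cls p), cls_eq_iff]
    cases i with
    | zero =>
      have hz0 : (z : Ωdeg k A 0) = 0 := AddSubgroup.mem_bot.mp hw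
      exact ⟨0, by simp [hz0]⟩
    | succ i =>
      obtain ⟨u, hu⟩ := hw
      exact ⟨u, by rw [← coe_dDeg, hu]; simp⟩
  · intro y
    obtain ⟨z, rfl⟩ := QuotientAddGroup.mk_surjective y
    -- A total preimage of the class of `z` need not be homogeneous. Its component of degree `i`
    -- also works: the degree `i` part of the exact form comparing representatives is again exact.
    obtain ⟨w, hw⟩ := h.2 (cls p ⟨_, mem_closed z⟩)
    obtain ⟨y, hy, hy'⟩ := exists_invCartierHom_component p w
    obtain ⟨h1, h2⟩ := hy' i
    refine ⟨⟨component i w, component_mem i w⟩, invCartier_eq p ?_⟩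
    rw [invCartierRel_iff, h2, cls_eq_iff]
    obtain ⟨u, hu⟩ := (cls_eq_iff p _ _).mp (hy.symm.trans hw)
    obtain ⟨v, hv⟩ := exists_d_eq_component u i
    refine ⟨v, ?_⟩
    rw [hv, hu, map_sub]
    congr 1
    exact component_of_mem (z : Ωdeg k A i).2

end Degree
end DeRham

/-! ### Logarithmic coordinates on smooth algebras -/

namespace DeRham

-- Being étale over a polynomial ring, `A` is flat there and embeds into its base change to the
-- fraction field; that base change is unramified over a field, hence reduced.
open TensorProduct in
theorem isReduced_of_isStandardSmooth (k A : Type*) [Field k] [CommRing A] [Algebra k A]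
    [Algebra.IsStandardSmooth k A] : IsReduced A := by
  obtain ⟨n, g, -, hg⟩ := RingHom.IsStandardSmooth.exists_etale_mvPolynomial
    ((RingHom.isStandardSmooth_algebraMap (R := k) (S := A)).mpr inferInstance)
  let _ : Algebra (MvPolynomial (Fin n) k) A := g.toAlgebra
  have : Algebra.Etale (MvPolynomial (Fin n) k) A := hg
  let K := FractionRing (MvPolynomial (Fin n) k)
  have : IsReduced (K ⊗[MvPolynomial (Fin n) k] A) :=
    Algebra.FormallyUnramified.isReduced_of_field K _
  exact isReduced_of_injective (Algebra.TensorProduct.includeRight :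
    A →ₐ[MvPolynomial (Fin n) k] K ⊗[MvPolynomial (Fin n) k] A)
    (Algebra.TensorProduct.includeRight_injective (IsFractionRing.injective _ K))

/-- Near each point, a standard smooth algebra has invertible coordinates. -/
theorem exists_logCoordinates (k A : Type u) [Field k] [CommRing A] [Algebra k A]
    [Algebra.IsStandardSmooth k A] (P : Ideal A) [P.IsPrime] : ∃ u : A, u ∉ P ∧
    ∀ (B : Type u) [CommRing B] [Algebra k B] [Algebra A B] [IsScalarTower k A B] (f : A)
      [IsLocalization.Away f B], u ∣ f →
      ∃ (I : Type) (_ : Fintype I), Nonempty (LogCoordinates k B I) := by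
  classical
  obtain ⟨-, I, b, hb⟩ := (Algebra.IsStandardSmooth.iff_exists_basis_kaehlerDifferential
    (R := k) (S := A)).mp inferInstance
  have : Nontrivial A := ⟨0, 1, fun h => (Ideal.ne_top_iff_one P).mp ‹P.IsPrime›.ne_top (h ▸ P.zero_mem)⟩
  have : Finite I := Module.Finite.finite_basis b
  let _ : Fintype I := Fintype.ofFinite I
  -- A coordinate vanishing at `P` is shifted by `1`, which leaves its differential unchanged.
  have h (i : I) : ∃ y : A, y ∉ P ∧ KaehlerDifferential.D k A y = b i := by
    obtain ⟨a, ha⟩ := hb ⟨i, rfl⟩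
    by_cases haP : a ∈ P
    · refine ⟨a + 1, fun h => (Ideal.ne_top_iff_one P).mp ‹P.IsPrime›.ne_top
        ((Ideal.add_mem_iff_right P haP).mp h), ?_⟩
      rw [map_add, Derivation.map_one_eq_zero, add_zero, ha]
    · exact ⟨a, haP, ha⟩
  choose y hy hyb using h
  -- Inverting any multiple `f` of this product makes all coordinates units, which leaves room to
  -- shrink the neighbourhood afterwards.
  refine ⟨∏ i, y i, fun h => ?_, ?_⟩
  · obtain ⟨i, -, hi⟩ := (Ideal.IsPrime.prod_mem_iff (p := P)).mp h
    exact hy i hi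
  intro B _ _ _ _ f _ hf
  have hunit (i : I) : IsUnit (algebraMap A B (y i)) :=
    isUnit_of_dvd_unit (map_dvd _ ((Finset.dvd_prod_of_mem y (Finset.mem_univ i)).trans hf))
      (IsLocalization.Away.algebraMap_isUnit f)
  let b' := b.ofIsLocalizedModule B (Submonoid.powers f) (KaehlerDifferential.map k k A B)
  let x (i : I) : Bˣ := (hunit i).unit
  refine ⟨I, inferInstance, ⟨⟨x, b'.unitsSMul fun i => (x i)⁻¹, fun i => ?_⟩⟩⟩
  rw [Module.Basis.unitsSMul_apply, Units.smul_def, smul_smul, Units.mul_inv, one_smul,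
    Module.Basis.ofIsLocalizedModule_apply, ← hyb, KaehlerDifferential.map_D]
  rfl

/-- Near each point of a standard smooth algebra over a perfect field, the inverse Cartier operator
is bijective. -/
theorem exists_invCartier_bijective (p : ℕ) [Fact p.Prime] (k A : Type u) [Field k] [CharP k p]
    [PerfectField k] [CommRing A] [Algebra k A] [Algebra.IsStandardSmooth k A] (P : Ideal A)
    [P.IsPrime] : ∃ u : A, u ∉ P ∧
    ∀ (B : Type u) [CommRing B] [Algebra k B] [Algebra A B] [IsScalarTower k A B] (f : A)
      [IsLocalization.Away f B], u ∣ f → ∀ i,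
      Function.Bijective (invCartier p i : Ωdeg k B i → HDeg k B i) := by
  obtain ⟨u, hu, h⟩ := exists_logCoordinates k A P
  refine ⟨u, hu, fun B _ _ _ _ f _ hf i => ?_⟩
  obtain ⟨I, _, ⟨c⟩⟩ := h B f hf
  have : IsReduced A := isReduced_of_isStandardSmooth k A
  have : IsReduced B := isReduced_localizationPreserves (Submonoid.powers f) B inferInstance
  have : Algebra.FiniteType A B := IsLocalization.finiteType_of_monoid_fg (Submonoid.powers f) B
  have : Algebra.FiniteType k B := Algebra.FiniteType.trans inferInstance this
  exact invCartier_bijective p (LogCoordinates.invCartierHom_bijective p c) i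

end DeRham

/-! ### Good neighbourhoods on a smooth scheme -/

namespace DeRham

section Local

variable (p : ℕ) [hp : Fact p.Prime] (k : Type u) [Field k] (X : Scheme.{u}) [X.Over (Spec (.of k))]

/-- The spectrum of a field is a single point, so the nonempty open `U` is everything and its ring
of sections is `k`. -/
theorem isStandardSmooth_of_appLE {U : (Spec (.of k)).Opens} {V : X.Opens} {x : X} (hx : x ∈ V)
    (e : V ≤ (X ↘ Spec (.of k)) ⁻¹ᵁ U)
    (h : ((X ↘ Spec (.of k)).appLE U V e).hom.IsStandardSmooth) :
    Algebra.IsStandardSmooth k Γ(X, V) := by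
  have hU : U = ⊤ := by
    refine top_unique fun y _ => ?_
    have : (X ↘ Spec (.of k)) x ∈ U := e hx
    have hy : y = (X ↘ Spec (.of k)) x := Subsingleton.elim (α := PrimeSpectrum k) _ _
    rwa [hy]
  subst hU
  have h1 : ((Scheme.ΓSpecIso (.of k)).inv).hom.IsStandardSmooth :=
    (RingHom.IsStandardSmoothOfRelativeDimension.equiv
      (Scheme.ΓSpecIso (.of k)).symm.commRingCatIsoToRingEquiv).isStandardSmooth
  exact h.comp h1

/-- Each point of a smooth scheme over a perfect field has arbitrarily small open neighbourhoods on
whose sections the inverse Cartier operator is bijective. -/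
theorem exists_opens_invCartier_bijective [CharP k p] [PerfectField k]
    [Smooth (X ↘ Spec (.of k))] (U : X.Opens) (x : X) (hx : x ∈ U) :
    ∃ V : X.Opens, x ∈ V ∧ V ≤ U ∧ ∀ i,
      Function.Bijective (invCartier p i : Ωdeg k Γ(X, V) i → HDeg k Γ(X, V) i) := by
  obtain ⟨T, -, V, hV, hxV, e, h⟩ := Smooth.exists_isStandardSmooth (X ↘ Spec (.of k)) x
  have := isStandardSmooth_of_appLE k X hxV e h
  obtain ⟨f, hf, hxf⟩ := hV.exists_basicOpen_le ⟨x, hx⟩ hxV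
  obtain ⟨g, hg, H⟩ := exists_invCartier_bijective p k Γ(X, V)
    ((IsLocalRing.maximalIdeal (X.presheaf.stalk x)).comap (X.presheaf.germ V x hxV).hom)
  have hxg : x ∈ X.basicOpen g := by
    rw [X.mem_basicOpen g x hxV]
    by_contra h
    exact hg h
  -- The factor `f` brings the neighbourhood inside `U`, and `g` makes the inverse Cartier operator
  -- bijective.
  refine ⟨X.basicOpen (f * g), ?_, ?_, ?_⟩
  · rw [Scheme.basicOpen_mul]; exact ⟨hxf, hxg⟩
  · rw [Scheme.basicOpen_mul]; exact inf_le_left.trans hf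
  have := hV.isLocalization_basicOpen (f * g)
  have : IsScalarTower k Γ(X, V) Γ(X, X.basicOpen (f * g)) :=
    IsScalarTower.of_algebraMap_eq fun c =>
      ((res k X (homOfLE (X.basicOpen_le (f * g))).op).commutes c).symm
  exact H Γ(X, X.basicOpen (f * g)) (f * g) (Dvd.intro_left f rfl)

end Local
end DeRham

/-! ### Exactness for sheaves of modules in terms of local sections -/

namespace DeRham

open TopologicalSpace Opposite Limits

section LocalSections

variable {X : Scheme.{u}}

section Presheaf

variable {P Q : X.PresheafOfModules} (f : P ⟶ Q)

theorem exists_map_eq_zero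
    [PresheafOfModules.IsLocallyInjective (Opens.grothendieckTopology X) f] {U : X.Opens}
    (s : P.obj (op U)) (hs : f.app _ s = 0) (x : X) (hx : x ∈ U) :
    ∃ (V : X.Opens) (i : V ⟶ U), x ∈ V ∧ P.map i.op s = 0 := by
  obtain ⟨V, i, h, hxV⟩ := Presheaf.equalizerSieve_mem (Opens.grothendieckTopology X)
    ((PresheafOfModules.toPresheaf _).map f) (X := op U) s (0 : P.obj (op U))
    (hs.trans (map_zero (f.app (op U)).hom).symm) x hx
  exact ⟨V, i, hxV, h.trans (map_zero (P.map i.op).hom)⟩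

theorem exists_app_eq_map
    [PresheafOfModules.IsLocallySurjective (Opens.grothendieckTopology X) f] {U : X.Opens}
    (t : Q.obj (op U)) (x : X) (hx : x ∈ U) :
    ∃ (V : X.Opens) (i : V ⟶ U), x ∈ V ∧ ∃ s : P.obj (op V), f.app _ s = Q.map i.op t := by
  obtain ⟨V, i, h, hxV⟩ := Presheaf.imageSieve_mem (Opens.grothendieckTopology X)
    ((PresheafOfModules.toPresheaf _).map f) (U := op U) t x hx
  exact ⟨V, i, hxV, h⟩

theorem isLocallyInjective_of_exists
    (h : ∀ {U : X.Opens} (s : P.obj (op U)), f.app _ s = 0 → ∀ x ∈ U,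
      ∃ (V : X.Opens) (i : V ⟶ U), x ∈ V ∧ P.map i.op s = 0) :
    PresheafOfModules.IsLocallyInjective (Opens.grothendieckTopology X) f := by
  refine ⟨fun {U} s t hst x hx => ?_⟩
  obtain ⟨V, i, hxV, hV⟩ := h (U := U.unop) (show P.obj U from s - t)
    ((map_sub (f.app U).hom s t).trans (sub_eq_zero.mpr hst)) x hx
  exact ⟨V, i, sub_eq_zero.mp ((map_sub (P.map i.op).hom s t).symm.trans hV), hxV⟩

theorem isLocallySurjective_of_exists
    (h : ∀ {U : X.Opens} (t : Q.obj (op U)), ∀ x ∈ U,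
      ∃ (V : X.Opens) (i : V ⟶ U), x ∈ V ∧ ∃ s : P.obj (op V), f.app _ s = Q.map i.op t) :
    PresheafOfModules.IsLocallySurjective (Opens.grothendieckTopology X) f := by
  refine ⟨fun {U} t x hx => ?_⟩
  obtain ⟨V, i, hxV, hV⟩ := h t x hx
  exact ⟨V, i, hV, hxV⟩

/-- Cokernels of presheaves of modules are computed on sections, evaluation being exact. -/
theorem exists_app_eq_of_cokernel {U : X.Opens} (t : Q.obj (op U))
    (ht : (cokernel.π f).app _ t = 0) : ∃ s : P.obj (op U), f.app _ s = t :=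
  (ShortComplex.moduleCat_exact_iff _).mp
    ((ShortComplex.exact_cokernel f).map (PresheafOfModules.evaluation _ (op U))) t ht

end Presheaf

variable {M N : X.Modules}

theorem eq_zero_of_mono (f : M ⟶ N) [Mono f] {U : X.Opens} (s : M.val.obj (op U))
    (hs : f.val.app _ s = 0) : s = 0 := by
  have : Mono f.val := inferInstanceAs (Mono ((Scheme.Modules.toPresheafOfModules X).map f))
  exact PresheafOfModules.injective_of_mono (f := f.val) (op U)
    (hs.trans (map_zero (f.val.app (op U)).hom).symm)

/-- In an exact sequence of sheaves of modules, sections in the kernel are locally images. -/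
theorem exists_app_eq_map_of_exact {S : ShortComplex X.Modules} (hS : S.Exact) {U : X.Opens}
    (t : S.X₂.val.obj (op U)) (ht : S.g.val.app _ t = 0) (x : X) (hx : x ∈ U) :
    ∃ (V : X.Opens) (i : V ⟶ U), x ∈ V ∧
      ∃ s : S.X₁.val.obj (op V), S.f.val.app _ s = S.X₂.val.map i.op t := by
  -- `Q` is the presheaf cokernel. The map `h` to its sheafification factors through the opcycles,
  -- where `t` already vanishes because exactness embeds them in `S.X₃`. Hence `t` becomes zero in
  -- `Q` locally, and there it lifts.
  let Q := cokernel S.f.val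
  let T : X.Modules := (PresheafOfModules.sheafification (𝟙 X.ringCatSheaf.obj)).obj Q
  let h : S.X₂ ⟶ T :=
    ⟨cokernel.π S.f.val ≫ toShf Q⟩
  have hh : S.f ≫ h = 0 := SheafOfModules.hom_ext (by
    change S.f.val ≫ cokernel.π S.f.val ≫ toShf Q = 0
    rw [cokernel.condition_assoc, zero_comp])
  have h1 : S.pOpcycles.val.app _ t = 0 := by
    have := hS.mono_fromOpcycles
    refine eq_zero_of_mono S.fromOpcycles _ ?_
    rw [← ht, ← S.p_fromOpcycles]
    rfl
  have h2 : h.val.app _ t = 0 := by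
    rw [← S.p_descOpcycles h hh]
    change (S.descOpcycles h hh).val.app _ (S.pOpcycles.val.app _ t) = 0
    rw [h1]
    exact map_zero _
  obtain ⟨V, i, hxV, hV⟩ := exists_map_eq_zero (toShf Q) _ h2 x hx
  refine ⟨V, i, hxV, exists_app_eq_of_cokernel S.f.val _ ?_⟩
  exact (PresheafOfModules.naturality_apply (cokernel.π S.f.val) i.op t).trans hV

instance isLocallySurjective_of_epi (f : M ⟶ N) [Epi f] :
    PresheafOfModules.IsLocallySurjective (Opens.grothendieckTopology X) f.val :=
  isLocallySurjective_of_exists _ fun t => exists_app_eq_map_of_exact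
    (S := ShortComplex.mk f (0 : N ⟶ N) comp_zero)
    ((ShortComplex.exact_iff_epi _ rfl).mpr inferInstance) t rfl

theorem epi_of_isLocallySurjective (f : M ⟶ N)
    [PresheafOfModules.IsLocallySurjective (Opens.grothendieckTopology X) f.val] : Epi f := by
  have : Sheaf.IsLocallySurjective ((SheafOfModules.toSheaf X.ringCatSheaf).map f) :=
    inferInstanceAs (PresheafOfModules.IsLocallySurjective (Opens.grothendieckTopology X) f.val)
  exact (SheafOfModules.toSheaf X.ringCatSheaf).epi_of_epi_map
    (Sheaf.epi_of_isLocallySurjective _)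

/-- The Frobenius is the identity on the underlying space, so push-forward changes only the module
structure on sections and preserves local surjectivity. -/
instance pushforward_frobenius_map_epi (p : ℕ) [Fact p.Prime] (k : Type u) [Field k] [CharP k p]
    [X.Over (Spec (.of k))] (f : M ⟶ N) [Epi f] :
    Epi ((Scheme.Modules.pushforward (frobenius p k X)).map f) := by
  have : PresheafOfModules.IsLocallySurjective (Opens.grothendieckTopology X)
    ((Scheme.Modules.pushforward (frobenius p k X)).map f).val :=
      inferInstanceAs (PresheafOfModules.IsLocallySurjective _ ((Fpre p k X).map f.val))
  exact epi_of_isLocallySurjective _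

end LocalSections

end DeRham

/-! ### The Cartier isomorphism of sheaves -/

namespace DeRham

open TopologicalSpace Opposite Limits

theorem mapDeg_mem_BDeg {k A B : Type u} [CommRing k] [CommRing A] [CommRing B] [Algebra k A]
    [Algebra k B] (φ : A →ₐ[k] B) {i : ℕ} {w : Ωdeg k A i} (hw : w ∈ BDeg k A i) :
    mapDeg φ i w ∈ BDeg k B i := by
  cases i with
  | zero =>
    rw [AddSubgroup.mem_bot.mp hw, map_zero]
    exact zero_mem _
  | succ i =>
    obtain ⟨v, rfl⟩ := hw
    exact ⟨mapDeg φ i v, Subtype.ext (map_d φ v).symm⟩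

section InverseCartier

theorem app_injective_of_mono {X : Scheme.{u}} {M N : X.Modules} (f : M ⟶ N) [Mono f]
    {U : X.Opens} {s t : M.val.obj (op U)} (h : f.val.app _ s = f.val.app _ t) : s = t :=
  sub_eq_zero.mp (eq_zero_of_mono f _
    ((map_sub (f.val.app (op U)).hom s t).trans (sub_eq_zero.mpr h)))

variable (p : ℕ) [Fact p.Prime] (k : Type u) [Field k] [CharP k p]
  (X : Scheme.{u}) [X.Over (Spec (.of k))]

theorem app_congr {P Q : X.PresheafOfModules} {f g : P ⟶ Q} (h : f = g) {U : X.Opensᵒᵖ}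
    (s : P.obj U) : f.app U s = g.app U s := by rw [h]

/-- The canonical map from the presheaf of closed forms to the cycles of `F_*Ω^•`. -/
noncomputable def closedToCycles (i : ℕ) :
    (closedPre p k X i).toPresheafOfModules ⟶ ((FΩComplex p k X).cycles i).val :=
  toClosedShf p k X i ≫ (toCyclesSheaf p k X i).val

theorem closedToCycles_iCycles (i : ℕ) :
    closedToCycles p k X i ≫ (ZOneι p k X i).val = (closedPre p k X i).ι ≫ toFΩ p k X i := by
  change toClosedShf p k X i ≫ (toCyclesSheaf p k X i ≫ (FΩComplex p k X).iCycles i).val = _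
  refine (congrArg (fun g => toClosedShf p k X i ≫ SheafOfModules.Hom.val g)
    (toCyclesSheaf_iCycles p k X i)).trans ?_
  exact fac_descend _ _

theorem ZOneι_Fd (i : ℕ) : ZOneι p k X i ≫ Fd p k X i = 0 := by
  rw [← FΩComplex_d]
  exact (FΩComplex p k X).iCycles_d i (i + 1)

instance (i : ℕ) : Mono (ZOneι p k X i) :=
  inferInstanceAs (Mono ((FΩComplex p k X).iCycles i))

/-- A section of `Z₁Ωⁱ` is locally given by a form `w`. As `dw` is zero in the sheaf, it is zero as
a form on a smaller open, where `w` is closed. -/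
instance closedToCycles_isLocallySurjective (i : ℕ) :
    PresheafOfModules.IsLocallySurjective (Opens.grothendieckTopology X)
      (closedToCycles p k X i) := by
  refine isLocallySurjective_of_exists _ fun {U} c x hx => ?_
  obtain ⟨V, a, hxV, w, hw⟩ := exists_app_eq_map (toFΩ p k X i) ((ZOneι p k X i).val.app _ c) x hx
  have hd : (toFΩ p k X (i + 1)).app _ ((dPre p k X i).app _ w) = 0 := by
    refine (app_congr X (toFΩ_Fd p k X i) w).symm.trans ?_
    change (Fd p k X i).val.app _ ((toFΩ p k X i).app _ w) = 0
    rw [hw]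
    refine (PresheafOfModules.naturality_apply (Fd p k X i).val a.op _).trans ?_
    refine (congrArg _ (app_congr X (congrArg (fun g => g.val) (ZOneι_Fd p k X i)) c)).trans ?_
    exact map_zero ((FΩ p k X (i + 1)).val.map a.op).hom
  obtain ⟨W, b, hxW, hW⟩ := exists_map_eq_zero (toFΩ p k X (i + 1)) _ hd x hxV
  refine ⟨W, b ≫ a, hxW, ⟨(FformsPre p k X i).map b.op w,
    (PresheafOfModules.naturality_apply (dPre p k X i) b.op w).trans hW⟩, ?_⟩
  refine app_injective_of_mono (ZOneι p k X i) ?_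
  refine (app_congr X (closedToCycles_iCycles p k X i) _).trans ?_
  refine (PresheafOfModules.naturality_apply (toFΩ p k X i) b.op w).trans ?_
  rw [hw]
  refine Eq.trans ?_ (PresheafOfModules.naturality_apply (ZOneι p k X i).val (b ≫ a).op c).symm
  exact (ConcreteCategory.congr_hom ((FΩ p k X i).val.presheaf.map_comp a.op b.op) _).symm

instance closedToHomology_isLocallySurjective (i : ℕ) :
    PresheafOfModules.IsLocallySurjective (Opens.grothendieckTopology X)
      (closedToHomology p k X i) := by
  refine isLocallySurjective_of_exists _ fun {U} t x hx => ?_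
  obtain ⟨V, a, hxV, c, hc⟩ := exists_app_eq_map ((FΩComplex p k X).homologyπ i).val t x hx
  obtain ⟨W, b, hxW, z, hz⟩ := exists_app_eq_map (closedToCycles p k X i) c x hxV
  refine ⟨W, b ≫ a, hxW, z, ?_⟩
  change ((FΩComplex p k X).homologyπ i).val.app _ ((closedToCycles p k X i).app _ z) = _
  rw [hz]
  refine (PresheafOfModules.naturality_apply ((FΩComplex p k X).homologyπ i).val b.op c).trans ?_
  rw [hc]
  exact (ConcreteCategory.congr_hom
    (((FΩComplex p k X).homology i).val.presheaf.map_comp a.op b.op) _).symm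

/-- The index `j` is the predecessor in the sense of the complex shape, so that all degrees are
covered: for `i = 0` it is `0` itself with zero differential, and the conclusion says that `c`
vanishes locally. -/
theorem exists_toCycles_eq (i j : ℕ) (hj : (ComplexShape.up ℕ).prev i = j) {U : X.Opens}
    (c : (ZOne p k X i).val.obj (op U))
    (hc : ((FΩComplex p k X).homologyπ i).val.app _ c = 0) (x : X) (hx : x ∈ U) :
    ∃ (V : X.Opens) (a : V ⟶ U), x ∈ V ∧ ∃ y : ((FΩComplex p k X).X j).val.obj (op V),
      ((FΩComplex p k X).d j i).val.app _ y =
        (ZOneι p k X i).val.app (op V) ((ZOne p k X i).val.map a.op c) := by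
  have hS : (ShortComplex.mk _ _ ((FΩComplex p k X).toCycles_comp_homologyπ j i)).Exact :=
    ShortComplex.exact_of_g_is_cokernel _ ((FΩComplex p k X).homologyIsCokernel j i hj)
  obtain ⟨V, a, hxV, y, hy⟩ := exists_app_eq_map_of_exact hS c hc x hx
  refine ⟨V, a, hxV, y, ?_⟩
  rw [← (FΩComplex p k X).toCycles_i j i]
  exact congrArg _ hy

/-- A closed form whose class in the cohomology sheaf vanishes is locally exact. -/
theorem exists_mem_BDeg (i : ℕ) {U : X.Opens} (z : ZDeg k Γ(X, U) i)
    (hz : (closedToHomology p k X i).app (op U) (toClosedPre p k X i (op U) z) = 0)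
    (x : X) (hx : x ∈ U) : ∃ (V : X.Opens) (a : V ⟶ U), x ∈ V ∧
      mapDeg (res k X a.op) i (z : Ωdeg k Γ(X, U) i) ∈ BDeg k Γ(X, V) i := by
  have key (V : X.Opens) (a : V ⟶ U) : (ZOneι p k X i).val.app (op V) ((ZOne p k X i).val.map a.op
      ((closedToCycles p k X i).app (op U) (toClosedPre p k X i (op U) z))) =
      (toFΩ p k X i).app (op V) (mapDeg (res k X a.op) i (z : Ωdeg k Γ(X, U) i)) := by
    refine (PresheafOfModules.naturality_apply (ZOneι p k X i).val a.op _).trans ?_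
    refine (congrArg _ (app_congr X (closedToCycles_iCycles p k X i) _)).trans ?_
    exact (PresheafOfModules.naturality_apply (toFΩ p k X i) a.op _).symm
  cases i with
  | zero =>
    obtain ⟨V, a, hxV, y, hy⟩ := exists_toCycles_eq p k X 0 0 (by simp) _ hz x hx
    obtain ⟨W, b, hxW, hW⟩ := exists_map_eq_zero (toFΩ p k X 0) _ ((hy.trans (key V a)).symm.trans
      (app_congr X (congrArg (fun g => SheafOfModules.Hom.val g)
        ((FΩComplex p k X).shape 0 0 (by simp))) y)) x hxV
    refine ⟨W, b ≫ a, hxW, AddSubgroup.mem_bot.mpr ?_⟩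
    exact (ConcreteCategory.congr_hom ((formsAb k X 0).map_comp a.op b.op) _).trans hW
  | succ i =>
    obtain ⟨V, a, hxV, y, hy⟩ := exists_toCycles_eq p k X (i + 1) i (by simp) _ hz x hx
    replace hy := (app_congr X (congrArg (fun g => SheafOfModules.Hom.val g)
      (FΩComplex_d p k X i)) y).symm.trans (hy.trans (key V a))
    -- The primitive `y` is only a section of the sheaf. Locally it comes from a form `v`; then `dv`
    -- and `z` agree in the sheaf, hence as forms on a smaller open.
    obtain ⟨W, b, hxW, v, hv⟩ := exists_app_eq_map (toFΩ p k X i) y x hxV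
    have h : (toFΩ p k X (i + 1)).app (op W) ((show (FformsPre p k X (i + 1)).obj (op W) from
          (dPre p k X i).app (op W) v) - (show (FformsPre p k X (i + 1)).obj (op W) from
          (FformsPre p k X (i + 1)).map b.op
            (mapDeg (res k X a.op) (i + 1) (z : Ωdeg k Γ(X, U) (i + 1))))) = 0 := by
      refine (map_sub ((toFΩ p k X (i + 1)).app (op W)).hom _ _).trans (sub_eq_zero.mpr ?_)
      refine (app_congr X (toFΩ_Fd p k X i) v).symm.trans ?_
      change (Fd p k X i).val.app _ ((toFΩ p k X i).app _ v) = _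
      rw [hv]
      refine (PresheafOfModules.naturality_apply (Fd p k X i).val b.op _).trans ?_
      refine (congrArg _ hy).trans ?_
      exact (PresheafOfModules.naturality_apply (toFΩ p k X (i + 1)) b.op _).symm
    obtain ⟨W', c, hxW', hW'⟩ := exists_map_eq_zero (toFΩ p k X (i + 1)) _ h x hxW
    have h2 := sub_eq_zero.mp
      ((map_sub ((FformsPre p k X (i + 1)).map c.op).hom _ _).symm.trans hW')
    refine ⟨W', c ≫ b ≫ a, hxW', (show Ωdeg k Γ(X, W') i from (FformsPre p k X i).map c.op v), ?_⟩
    refine (PresheafOfModules.naturality_apply (dPre p k X i) c.op v).trans ?_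
    refine h2.trans ?_
    refine Eq.symm
      ((ConcreteCategory.congr_hom ((formsAb k X (i + 1)).map_comp (b ≫ a).op c.op) _).trans ?_)
    exact congrArg ((formsAb k X (i + 1)).map c.op).hom (ConcreteCategory.congr_hom ((formsAb k X (i + 1)).map_comp a.op b.op) _)

section Smooth

variable [PerfectField k] [Smooth (X ↘ Spec (.of k))]

/-- A section of the cohomology sheaf is locally the class of a closed form, which has a preimage on
a small open where the operator of algebras is bijective. -/
instance invCartierPre_isLocallySurjective (i : ℕ) :
    PresheafOfModules.IsLocallySurjective (Opens.grothendieckTopology X)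
      (invCartierPre p k X i) := by
  refine isLocallySurjective_of_exists _ fun {U} t x hx => ?_
  obtain ⟨V, a, hxV, z, hz⟩ := exists_app_eq_map (closedToHomology p k X i) t x hx
  obtain ⟨W, hxW, hWV, hW⟩ := exists_opens_invCartier_bijective p k X V x hxV
  obtain ⟨w, hw⟩ := (hW i).2 (QuotientAddGroup.mk
    (mapZDeg (res k X (homOfLE hWV).op) (⟨z.1, z.2⟩ : ZDeg k Γ(X, V) i)))
  refine ⟨W, homOfLE hWV ≫ a, hxW, w, ?_⟩
  refine (congrArg (cohToHomology p k X i (op W)) hw).trans ?_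
  refine (PresheafOfModules.naturality_apply (closedToHomology p k X i)
    (homOfLE hWV).op z).trans ?_
  rw [hz]
  exact (ConcreteCategory.congr_hom
    (((FΩComplex p k X).homology i).val.presheaf.map_comp a.op (homOfLE hWV).op) _).symm

/-- If the image of `w` vanishes, the closed form representing it is locally exact; injectivity on
the algebra of a smaller open then kills `w` there. -/
instance invCartierPre_isLocallyInjective (i : ℕ) :
    PresheafOfModules.IsLocallyInjective (Opens.grothendieckTopology X)
      (invCartierPre p k X i) := by
  refine isLocallyInjective_of_exists _ fun {U} w hw x hx => ?_
  obtain ⟨z, hz⟩ := exists_invCartierRel p (show Ωdeg k Γ(X, U) i from w)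
  have hw' : cohToHomology p k X i (op U) (invCartier p i (show Ωdeg k Γ(X, U) i from w)) = 0 := hw
  rw [invCartier_eq p hz, cohToHomology_mk] at hw'
  obtain ⟨V, a, hxV, hV⟩ := exists_mem_BDeg p k X i z hw' x hx
  obtain ⟨W, hxW, hWV, hW⟩ := exists_opens_invCartier_bijective p k X V x hxV
  refine ⟨W, homOfLE hWV ≫ a, hxW, ?_⟩
  refine (ConcreteCategory.congr_hom ((formsAb k X i).map_comp a.op (homOfLE hWV).op) _).trans ?_
  refine (injective_iff_map_eq_zero _).mp (hW i).1 _ ?_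
  refine (invCartier_eq p ((hz.map p (res k X a.op)).map p (res k X (homOfLE hWV).op))).trans ?_
  refine (QuotientAddGroup.eq_zero_iff _).mpr ?_
  exact AddSubgroup.mem_addSubgroupOf.mpr (mapDeg_mem_BDeg (res k X (homOfLE hWV).op) hV)

/-- Both `toΩ` and `invCartierPre` are locally bijective maps from the presheaf of forms to a sheaf,
so each exhibits its target as the sheafification. -/
instance invCartierSheaf_isIso (i : ℕ) : IsIso (invCartierSheaf p k X i) := by
  refine ⟨descend (invCartierPre p k X i) (toΩ k X i), ?_, ?_⟩
  · apply hom_ext_of_descend (toΩ k X i)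
    rw [val_comp, ← Category.assoc, invCartierSheaf, fac_descend, fac_descend]
    exact (Category.comp_id _).symm
  · apply hom_ext_of_descend (invCartierPre p k X i)
    rw [val_comp, ← Category.assoc, fac_descend, invCartierSheaf, fac_descend]
    exact (Category.comp_id _).symm

end Smooth

end InverseCartier

end DeRham

/-! ### Higher Cartier operators and the Cartesian square -/

namespace DeRham

open Limits

/-- The kernel of `f ≫ g` is the pullback along `f` of the kernel of `g`; that `f` is an epimorphism
keeps the composite epimorphic. -/
theorem shortExact_of_isPullback {C : Type*} [Category C] [Abelian C] {K M N P B : C}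
    {ι : K ⟶ M} {g : M ⟶ B} {w : ι ≫ g = 0} (h : (ShortComplex.mk ι g w).ShortExact)
    {j : P ⟶ N} {b : P ⟶ K} {f : N ⟶ M} [Epi f] (hP : IsPullback j b f ι) :
    ∃ w : j ≫ f ≫ g = 0, (ShortComplex.mk j (f ≫ g) w).ShortExact := by
  have := h.mono_f
  have := h.epi_g
  dsimp at *
  have hw : j ≫ f ≫ g = 0 := by rw [hP.w_assoc, w, comp_zero]
  have : Mono j := ⟨fun a b hab => hP.hom_ext hab ((cancel_mono ι).mp (by
    rw [Category.assoc, Category.assoc, ← hP.w, reassoc_of% hab]))⟩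
  have hl : IsLimit (KernelFork.ofι j hw) := KernelFork.IsLimit.ofι' j hw fun a ha =>
    ⟨hP.lift a (h.exact.lift (a ≫ f) (by simpa using ha)) (h.exact.lift_f _ _).symm,
      hP.lift_fst _ _ _⟩
  exact ⟨hw,
    { exact := ShortComplex.exact_of_f_is_kernel _ hl
      mono_f := this
      epi_g := epi_comp f g }⟩

section HigherCartier

variable (p : ℕ) [Fact p.Prime] (k : Type u) [Field k] [CharP k p]
  (X : Scheme.{u}) [X.Over (Spec (.of k))] (i : ℕ)

theorem ZOneι_dToBOne_shortExact : ∃ w : ZOneι p k X i ≫ dToBOne p k X i = 0,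
    (ShortComplex.mk (ZOneι p k X i) (dToBOne p k X i) w).ShortExact := by
  have hf : dToBOne p k X i ≫ image.ι (Fd p k X i) = Fd p k X i := image.fac _
  have hw : ZOneι p k X i ≫ dToBOne p k X i = 0 := by
    refine (cancel_mono (image.ι (Fd p k X i))).mp ?_
    exact (Category.assoc _ _ _).trans
      ((congrArg _ hf).trans ((ZOneι_Fd p k X i).trans zero_comp.symm))
  have hl : IsLimit (KernelFork.ofι (ZOneι p k X i) hw) := KernelFork.IsLimit.ofι' _ hw
    fun a ha => ⟨(FΩComplex p k X).liftCycles a (i + 1) (by simp) (by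
      rw [FΩComplex_d, ← hf]
      exact (Category.assoc _ _ _).symm.trans ((congrArg (· ≫ _) ha).trans zero_comp)),
      (FΩComplex p k X).liftCycles_i _ _ _ _⟩
  exact ⟨hw,
    { exact := ShortComplex.exact_of_f_is_kernel _ hl
      mono_f := inferInstanceAs (Mono (ZOneι p k X i))
      epi_g := inferInstanceAs (Epi (factorThruImage (Fd p k X i))) }⟩

instance Fpow_map_epi (n : ℕ) {M N : X.Modules} (f : M ⟶ N) [Epi f] :
    Epi ((Fpow p k X n).map f) := by
  induction n generalizing M N with
  | zero => exact inferInstanceAs (Epi f)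
  | succ n ih =>
    exact ih ((Scheme.Modules.pushforward (frobenius p k X)).map f)

/-- Purely formal from the pullbacks defining `Z`. The inclusion `j` and the Cartesian square are
constructed together, since the compatibility of `j` with the ambient inclusions is what lets the
next square be cut in two. -/
theorem exists_isPullback_higherCartier (n : ℕ) : ∃ j : Z p k X i (n + 1) ⟶
        (Scheme.Modules.pushforward (frobenius p k X)).obj (Z p k X i n),
      j ≫ (Scheme.Modules.pushforward (frobenius p k X)).map (Zι p k X i n) ≫
          (FpowSucc p k X n).hom.app (Ω k X i) = Zι p k X i (n + 1) ∧
      IsPullback j (ZtoZOne p k X i n)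
        ((Scheme.Modules.pushforward (frobenius p k X)).map (higherCartier p k X i n))
        (ZOneι p k X i) := by
  induction n with
  | zero =>
    -- `Z₁` arises as a pullback along the identity of `Ωⁱ`, so it is identified with `ZOne`, and
    -- the square has two invertible sides.
    have : IsIso (ZtoFpowZOne p k X i 0) :=
      inferInstanceAs (IsIso (pullback.fst (cartier p k X i) (𝟙 (Ω k X i))))
    refine ⟨ZtoFpowZOne p k X i 0 ≫ ZOneι p k X i, ?_, ?_⟩
    · have h1 : (Scheme.Modules.pushforward (frobenius p k X)).map (Zι p k X i 0) = 𝟙 _ :=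
        CategoryTheory.Functor.map_id _ _
      have h2 : (FpowSucc p k X 0).hom.app (Ω k X i) = 𝟙 _ := Category.comp_id _
      rw [h1, h2]
      exact (congrArg _ (Category.comp_id _)).trans (Category.comp_id _)
    · have h1 : (Scheme.Modules.pushforward (frobenius p k X)).map (higherCartier p k X i 0) =
        𝟙 _ := CategoryTheory.Functor.map_id _ _
      have : IsIso (ZtoZOne p k X i 0) := this
      have : IsIso ((Scheme.Modules.pushforward (frobenius p k X)).map
          (higherCartier p k X i 0)) :=
        CategoryTheory.Functor.map_isIso _ (𝟙 (Ω k X i))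
      refine IsPullback.of_vert_isIso ⟨?_⟩
      rw [h1]
      exact Category.comp_id _
  | succ n ih =>
    obtain ⟨j, hj, hP⟩ := ih
    -- Naturality squares of an isomorphism are Cartesian. Pasting this one to F_* of the square
    -- defining `Zₙ₊₁` gives a pullback of Fⁿ⁺¹_*C.
    have hG := IsPullback.of_horiz_isIso (fst := (FpowSucc p k X n).hom.app (ZOne p k X i))
      ⟨((FpowSucc p k X n).hom.naturality (cartier p k X i)).symm⟩
    have hF := ((isPullback_Z p k X i n).map
      (Scheme.Modules.pushforward (frobenius p k X))).paste_horiz hG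
    have hZ := isPullback_Z p k X i (n + 1)
    rw [← hj] at hZ
    -- Both `Zₙ₊₂` and F_*Zₙ₊₁ are pullbacks of Fⁿ⁺¹_*C, the former along a map that factors through
    -- `j`; so the left-hand square is Cartesian, and stacking it on `hP` completes the induction.
    have hS := hZ.of_right' hF
    have hfst := hF.lift_fst (ZtoFpowZOne p k X i (n + 1)) (cartierRes p k X i (n + 1) ≫ j)
      (by rw [Category.assoc]; exact hZ.w)
    have hQ := hS.paste_vert hP
    rw [← Functor.map_comp] at hQ
    generalize hF.lift _ _ _ = j' at hfst hQ
    refine ⟨j', ?_, hQ⟩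
    -- With the convention Fⁿ⁺¹_* M = Fⁿ_*(F_* M), the identification at stage `n + 1` on `Ωⁱ` is
    -- the one at stage `n` on F_*Ωⁱ, so naturality along `ZOneι` applies.
    have h1 : (FpowSucc p k X (n + 1)).hom.app (Ω k X i) =
      (FpowSucc p k X n).hom.app (FΩ p k X i) := Category.id_comp _
    have h2 := (FpowSucc p k X n).hom.naturality (ZOneι p k X i)
    have h3 : (Scheme.Modules.pushforward (frobenius p k X)).map (Zι p k X i (n + 1)) =
      (Scheme.Modules.pushforward (frobenius p k X)).map (ZtoFpowZOne p k X i n) ≫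
        (Fpow p k X n ⋙ Scheme.Modules.pushforward (frobenius p k X)).map (ZOneι p k X i) :=
      CategoryTheory.Functor.map_comp _ _ _
    rw [h3, h1, Zι_succ p k X i (n + 1), ← hfst]
    exact (congrArg (j' ≫ ·) ((Category.assoc _ _ _).trans (congrArg _ h2))).trans
      ((congrArg (j' ≫ ·) (Category.assoc _ _ _).symm).trans (Category.assoc _ _ _).symm)

section Smooth

variable [PerfectField k] [Smooth (X ↘ Spec (.of k))]

/-- Smoothness and perfectness enter here: C⁻¹ is invertible, so C is the projection to cohomology
followed by an isomorphism. -/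
instance cartier_epi : Epi (cartier p k X i) := by
  rw [cartier, dif_pos (invCartierSheaf_isIso p k X i)]
  exact epi_comp _ _

/-- Epimorphisms survive base change in an abelian category, and Fⁿ_* preserves them. -/
instance cartierRes_epi (n : ℕ) : Epi (cartierRes p k X i n) :=
  inferInstanceAs (Epi (pullback.snd ((Fpow p k X n).map (cartier p k X i)) (Zι p k X i n)))

instance higherCartier_epi (n : ℕ) : Epi (higherCartier p k X i n) := by
  induction n with
  | zero => exact inferInstanceAs (Epi (𝟙 (Ω k X i)))
  | succ n ih => exact epi_comp (cartierRes p k X i n) (higherCartier p k X i n)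

end Smooth

end HigherCartier

end DeRham

open DeRham in
theorem mainTheorem6 (p : ℕ) [Fact p.Prime] (k : Type u) [Field k] [CharP k p] [PerfectField k]
    (X : Scheme.{u}) [X.Over (Spec (.of k))] [Smooth (X ↘ Spec (.of k))] (i n : ℕ) :
    IsIso (invCartierSheaf p k X i) ∧
    (∃ w : ZOneι p k X i ≫ dToBOne p k X i = 0,
      (ShortComplex.mk (ZOneι p k X i) (dToBOne p k X i) w).ShortExact) ∧
    ∃ j : Z p k X i (n + 1) ⟶
        (Scheme.Modules.pushforward (frobenius p k X)).obj (Z p k X i n),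
      j ≫ (Scheme.Modules.pushforward (frobenius p k X)).map (Zι p k X i n) ≫
          (FpowSucc p k X n).hom.app (Ω k X i) = Zι p k X i (n + 1) ∧
      (∃ w : j ≫ (Scheme.Modules.pushforward (frobenius p k X)).map (higherCartier p k X i n) ≫
          dToBOne p k X i = 0,
        (ShortComplex.mk j ((Scheme.Modules.pushforward (frobenius p k X)).map
          (higherCartier p k X i n) ≫ dToBOne p k X i) w).ShortExact) ∧
      IsPullback j (ZtoZOne p k X i n)
        ((Scheme.Modules.pushforward (frobenius p k X)).map (higherCartier p k X i n))
        (ZOneι p k X i) := by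
  obtain ⟨w, hw⟩ := ZOneι_dToBOne_shortExact p k X i
  obtain ⟨j, hj, hP⟩ := exists_isPullback_higherCartier p k X i n
  exact ⟨inferInstance, ⟨w, hw⟩, j, hj, shortExact_of_isPullback hw hP, hP⟩
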